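/- Let $M$ be a (Hausdorff) paracompact smooth manifold of dimension $n$, and let $A$ be a Weil algebra, i.e. a finite-dimensional commutative unital real algebra with a unique maximal ideal $\mathfrak m$, where $\mathfrak m$ has codimension $1$. An infinitely near point of $M$ of kind $A$ at $x\in M$ is a homomorphism of algebras $\xi:C^\infty(M)\to A$ with $\xi(f)-f(x)\in\mathfrak m$ for all $f\in C^\infty(M)$. Let $M^A$ be the set of all infinitely near points of kind $A$ (at all $x\in M$), with the smooth structure for which, for each chart $(U,x_1,\dots,x_n)$ of $M$, the map $\xi\mapsto(\xi(x_1),\dots,\xi(x_n))$ is a chart from $U^A$ (the points of $M^A$ over $U$) onto an open subset of $A^n$. Let $C^\infty(M^A,A)$ be the $A$-algebra of smooth functions $M^A\to A$, and $C^\infty(M^A)\subset C^\infty(M^A,A)$ the subset of those with values in $\mathbb R\subset A$. For $f\in C^\infty(M)$ let $f^A:M^A\to A$, $f^A(\xi)=\xi(f)$. Let $M$ be a Poisson manifold: $\{\,,\}$ is a real Lie bracket on $C^\infty(M)$ with $\{f,g h\}=\{f,g\}h+g\{f,h\}$ for all $f,g,h\in C^\infty(M)$. Then: 1. $g^A\in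 C^\infty(M^A,A)$ for every $g\in C^\infty(M)$. For every $f\in C^\infty(M)$ there is a unique $A$-linear derivation $\widetilde{[ad(f)]^A}$ of the algebra $C^\infty(M^A,A)$ that maps $C^\infty(M^A)$ into itself and satisfies $\widetilde{[ad(f)]^A}(g^A)=\{f,g\}^A$ for all $g\in C^\infty(M)$. 2. The map $C^\infty(M)\to \mathrm{Der}_A[C^\infty(M^A,A)]$, $f\mapsto\widetilde{[ad(f)]^A}$, is a representation of the real Lie algebra $(C^\infty(M),\{\,,\})$ on $C^\infty(M^A,A)$: it is $\mathbb R$-linear and $$\widetilde{[ad(\{f,g\})]^A}=\widetilde{[ad(f)]^A}\circ\widetilde{[ad(g)]^A}-\widetilde{[ad(g)]^A}\circ\widetilde{[ad(f)]^A}\qquad(f,g\in C^\infty(M)).$$ 3. This representation defines a cohomology operator $\widetilde d$. That is, for $p\ge 0$ let $\Lambda^p$ be the space of skew-symmetric $\mathbb R$-multilinear maps $\Omega$ of degree $p$ from $C^\infty(M)$ into $C^\infty(M^A,A)$. For each $p\ge0$ and $\Omega\in\Lambda^p$, the formula $$\widetilde d\,\Omega(f_1,\dots,f_{p+1})=\sum_{i=1}^{p+1}(-1)^{i-1}\,\widetilde{[ad(f_i)]^A}\bigl[\Omega(f_1,\dots,\widehat{f_i},\dots,f_{p+1})\bigr]+\sum_{1\le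 i<j\le p+1}(-1)^{i+j}\,\Omega(\{f_i,f_j\},f_1,\dots,\widehat{f_i},\dots,\widehat{f_j},\dots,f_{p+1})$$ (a hat marks an omitted argument) defines an element of $\Lambda^{p+1}$, the resulting map $\widetilde d:\Lambda^p\to\Lambda^{p+1}$ is $A$-linear, and $\widetilde d\circ\widetilde d=0$. -/

import Mathlib

open scoped Manifold ContDiff Topology

/-- A Weil algebra: a finite-dimensional commutative unital real algebra with a unique maximal
ideal, and this ideal has codimension one. -/
class IsWeilAlgebra (A : Type*) [CommRing A] [Algebra ℝ A] : Prop
    extends IsLocalRing A, Module.Finite ℝ A where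
  finrank_quotient : Module.finrank ℝ (A ⧸ IsLocalRing.maximalIdeal A) = 1

namespace WeilBundle

section Augmentation

variable (A : Type*) [CommRing A] [Algebra ℝ A] [IsWeilAlgebra A]

theorem bijective_algebraMap_quotient :
    Function.Bijective (Algebra.ofId ℝ (A ⧸ IsLocalRing.maximalIdeal A)) :=
  Algebra.finrank_eq_one_iff_bijective_algebraMap.mp IsWeilAlgebra.finrank_quotient

/-- The augmentation `A = ℝ ⊕ 𝔪 → ℝ`. -/
noncomputable def augmentation : A →ₐ[ℝ] ℝ :=
  ((AlgEquiv.ofBijective _ (bijective_algebraMap_quotient A)).symm : _ →ₐ[ℝ] ℝ).comp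
    (Ideal.Quotient.mkₐ ℝ (IsLocalRing.maximalIdeal A))

variable {A}

theorem sub_augmentation_mem (a : A) :
    a - algebraMap ℝ A (augmentation A a) ∈ IsLocalRing.maximalIdeal A := by
  rw [← Ideal.Quotient.mk_eq_mk_iff_sub_mem]
  have h := (AlgEquiv.ofBijective _ (bijective_algebraMap_quotient A)).apply_symm_apply
    (Ideal.Quotient.mk (IsLocalRing.maximalIdeal A) a)
  exact h.symm

theorem augmentation_eq_of_sub_mem (a : A) (r : ℝ)
    (h : a - algebraMap ℝ A r ∈ IsLocalRing.maximalIdeal A) : augmentation A a = r := by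
  have h1 : Ideal.Quotient.mk (IsLocalRing.maximalIdeal A) a =
      Ideal.Quotient.mk (IsLocalRing.maximalIdeal A) (algebraMap ℝ A r) :=
    Ideal.Quotient.mk_eq_mk_iff_sub_mem _ _ |>.mpr h
  have h2 : augmentation A a = augmentation A (algebraMap ℝ A r) :=
    congrArg (AlgEquiv.ofBijective _ (bijective_algebraMap_quotient A)).symm h1
  rw [h2, AlgHom.commutes]
  rfl

end Augmentation

section FiniteDimensional

variable {V W : Type*} [AddCommGroup V] [Module ℝ V] [Module.Finite ℝ V]
  [AddCommGroup W] [Module ℝ W] [Module.Finite ℝ W]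

/-- `G` is smooth (`C^∞`) on the subset `s` of the finite-dimensional real vector space `V`, that
is, smooth when it is read in linear coordinates of `V` and `W`. The choice of bases does not
matter. -/
def IsSmoothOn (G : V → W) (s : Set V) : Prop :=
  ContDiffOn ℝ ∞
    (fun v => (Module.finBasis ℝ W).equivFun (G ((Module.finBasis ℝ V).equivFun.symm v)))
    ((Module.finBasis ℝ V).equivFun.symm ⁻¹' s)

theorem IsSmoothOn.const (w : W) (s : Set V) : IsSmoothOn (fun _ => w) s :=
  contDiffOn_const

theorem IsSmoothOn.add {G H : V → W} {s : Set V} (hG : IsSmoothOn G s) (hH : IsSmoothOn H s) :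
    IsSmoothOn (fun v => G v + H v) s := by
  unfold IsSmoothOn at *
  simpa only [map_add] using ContDiffOn.add hG hH

theorem IsSmoothOn.mul {A : Type*} [CommRing A] [Algebra ℝ A] [Module.Finite ℝ A]
    {G H : V → A} {s : Set V} (hG : IsSmoothOn G s) (hH : IsSmoothOn H s) :
    IsSmoothOn (fun v => G v * H v) s := by
  let b := (Module.finBasis ℝ A).equivFun
  let B : (Fin (Module.finrank ℝ A) → ℝ) →ₗ[ℝ] (Fin (Module.finrank ℝ A) → ℝ) →ₗ[ℝ]
      (Fin (Module.finrank ℝ A) → ℝ) :=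
    ((LinearMap.mul ℝ A).compl₁₂ b.symm.toLinearMap b.symm.toLinearMap).compr₂ b.toLinearMap
  have key := (LinearMap.toContinuousBilinearMap B).isBoundedBilinearMap.contDiff (n := ∞)
  have h := key.comp_contDiffOn (ContDiffOn.prodMk hG hH)
  unfold IsSmoothOn
  refine h.congr fun v _ => ?_
  change b (G _ * H _) = b (b.symm (b (G _)) * b.symm (b (H _)))
  rw [b.symm_apply_apply, b.symm_apply_apply]

end FiniteDimensional

section Manifold

variable {n : ℕ} {M : Type*} [TopologicalSpace M] [ChartedSpace (EuclideanSpace ℝ (Fin n)) M]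

variable (n M) in
/-- A Poisson structure on `M`: a real Lie bracket on `C^∞(M)` such that every `ad(f) = {f, ·}` is
a derivation of the commutative algebra `C^∞(M)`. -/
structure PoissonBracket where
  bracket : C^∞⟮𝓡 n, M; ℝ⟯ →ₗ[ℝ] C^∞⟮𝓡 n, M; ℝ⟯ →ₗ[ℝ] C^∞⟮𝓡 n, M; ℝ⟯
  bracket_self : ∀ f, bracket f f = 0
  jacobi : ∀ f g h,
    bracket f (bracket g h) + bracket g (bracket h f) + bracket h (bracket f g) = 0
  leibniz : ∀ f g h, bracket f (g * h) = bracket f g * h + g * bracket f h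

variable (n M) in
/-- The set `M^A` of infinitely near points of `M` of kind `A`: pairs of a point `x` of `M` and a
homomorphism of algebras `ξ : C^∞(M) → A` with `ξ(f) - f(x) ∈ 𝔪` for all `f`. -/
structure NearPoint (A : Type*) [CommRing A] [Algebra ℝ A] [IsWeilAlgebra A] where
  base : M
  toAlgHom : C^∞⟮𝓡 n, M; ℝ⟯ →ₐ[ℝ] A
  sub_mem : ∀ f, toAlgHom f - algebraMap ℝ A (f base) ∈ IsLocalRing.maximalIdeal A

variable {A : Type*} [CommRing A] [Algebra ℝ A] [IsWeilAlgebra A]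

/-- The prolongation `f^A : M^A → A`, `ξ ↦ ξ(f)`. -/
noncomputable def prolong (f : C^∞⟮𝓡 n, M; ℝ⟯) : NearPoint n M A → A := fun ξ => ξ.toAlgHom f

/-- The value of an infinitely near point on a function `h` that is smooth near its base point:
the value on any global smooth function with the same germ. -/
noncomputable def NearPoint.evalGerm (ξ : NearPoint n M A) (h : M → ℝ) : A :=
  open Classical in
  if H : ∃ g : C^∞⟮𝓡 n, M; ℝ⟯, ⇑g =ᶠ[𝓝 ξ.base] h then ξ.toAlgHom H.choose else 0

section Locality

variable [IsManifold (𝓡 n) ∞ M] [T2Space M]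

theorem NearPoint.toAlgHom_congr (ξ : NearPoint n M A) {f g : C^∞⟮𝓡 n, M; ℝ⟯}
    (hfg : ⇑f =ᶠ[𝓝 ξ.base] ⇑g) : ξ.toAlgHom f = ξ.toAlgHom g := by
  obtain ⟨χ, -, hχ⟩ := (SmoothBumpFunction.nhds_basis_tsupport (I := 𝓡 n) ξ.base).mem_iff.mp hfg
  let c : C^∞⟮𝓡 n, M; ℝ⟯ := ⟨χ, χ.contMDiff⟩
  have hc : c * (f - g) = 0 := by
    ext y
    by_cases hy : y ∈ tsupport χ
    · have : f y = g y := hχ hy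
      change χ y * (f y - g y) = 0
      rw [this, sub_self, mul_zero]
    · change χ y * (f y - g y) = 0
      rw [image_eq_zero_of_notMem_tsupport hy, zero_mul]
  have hu : IsUnit (ξ.toAlgHom c) := by
    by_contra hn
    have h1 : ξ.toAlgHom c ∈ IsLocalRing.maximalIdeal A :=
      (IsLocalRing.mem_maximalIdeal _).mpr hn
    have h2 := ξ.sub_mem c
    have h3 : c ξ.base = 1 := χ.eq_one
    rw [h3, map_one] at h2
    have h4 := Ideal.sub_mem _ h1 h2
    rw [sub_sub_cancel] at h4
    exact (Ideal.ne_top_iff_one _).mp (IsLocalRing.maximalIdeal.isMaximal A).ne_top h4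
  have h0 : ξ.toAlgHom c * (ξ.toAlgHom f - ξ.toAlgHom g) = 0 := by
    rw [← map_sub, ← map_mul, hc, map_zero]
  exact sub_eq_zero.mp (hu.mul_right_eq_zero.mp h0)

/-- `evalGerm` does not depend on the choice of the global function. -/
theorem NearPoint.evalGerm_eq (ξ : NearPoint n M A) {h : M → ℝ} (g : C^∞⟮𝓡 n, M; ℝ⟯)
    (hg : ⇑g =ᶠ[𝓝 ξ.base] h) : ξ.evalGerm h = ξ.toAlgHom g := by
  have H : ∃ g : C^∞⟮𝓡 n, M; ℝ⟯, ⇑g =ᶠ[𝓝 ξ.base] h := ⟨g, hg⟩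
  rw [NearPoint.evalGerm, dif_pos H]
  exact ξ.toAlgHom_congr (H.choose_spec.trans hg.symm)

/-- A function that is smooth on a neighbourhood of a point has the germ of a global one. -/
theorem exists_germ_eq {x : M} {u : Set M} (hu : IsOpen u) (hx : x ∈ u) {h : M → ℝ}
    (hh : ContMDiffOn (𝓡 n) 𝓘(ℝ, ℝ) ∞ h u) :
    ∃ g : C^∞⟮𝓡 n, M; ℝ⟯, ⇑g =ᶠ[𝓝 x] h := by
  obtain ⟨χ, -, hχ⟩ :=
    (SmoothBumpFunction.nhds_basis_tsupport (I := 𝓡 n) x).mem_iff.mp (hu.mem_nhds hx)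
  refine ⟨⟨fun y => χ y * h y, ?_⟩, ?_⟩
  · refine contMDiff_of_tsupport fun y hy => ?_
    have hy' : y ∈ tsupport χ := tsupport_mul_subset_left hy
    exact χ.contMDiffAt.mul (hh.contMDiffAt (hu.mem_nhds (hχ hy')))
  · filter_upwards [χ.eventuallyEq_one] with y hy
    change χ y * h y = h y
    rw [hy, Pi.one_apply, one_mul]

end Locality

/-- The coordinates `(ξ(x₁), …, ξ(xₙ)) ∈ A^n` of an infinitely near point in a chart
`(U, x₁, …, xₙ)` of `M` (meaningful when the base point lies in `U`). -/
noncomputable def NearPoint.coord (e : OpenPartialHomeomorph M (EuclideanSpace ℝ (Fin n)))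
    (ξ : NearPoint n M A) : Fin n → A :=
  fun i => ξ.evalGerm (fun y => e y i)

variable (A) in
/-- The open subset of `A^n` which is the image of `U^A` under the coordinates of `U`: the vectors
whose augmentation lies in the image of the chart `U`. -/
noncomputable def coordTarget (e : OpenPartialHomeomorph M (EuclideanSpace ℝ (Fin n))) :
    Set (Fin n → A) :=
  {a | WithLp.toLp 2 (fun i => augmentation A (a i)) ∈ e.target}

theorem NearPoint.coord_mem [IsManifold (𝓡 n) ∞ M] [T2Space M]
    {e : OpenPartialHomeomorph M (EuclideanSpace ℝ (Fin n))}
    (he : e ∈ IsManifold.maximalAtlas (𝓡 n) ∞ M) (ξ : NearPoint n M A)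
    (hξ : ξ.base ∈ e.source) : ξ.coord e ∈ coordTarget A e := by
  have key : WithLp.toLp 2 (fun i => augmentation A (ξ.coord e i)) = e ξ.base := by
    ext i
    have hs : ContMDiffOn (𝓡 n) 𝓘(ℝ, ℝ) ∞ (fun y => e y i) e.source := by
      have h1 := contMDiffOn_of_mem_maximalAtlas he
      have h2 : ContMDiff 𝓘(ℝ, EuclideanSpace ℝ (Fin n)) 𝓘(ℝ, ℝ) ∞
          (fun v : EuclideanSpace ℝ (Fin n) => v i) :=
        (EuclideanSpace.proj i : EuclideanSpace ℝ (Fin n) →L[ℝ] ℝ).contDiff.contMDiff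
      exact h2.comp_contMDiffOn h1
    obtain ⟨g, hg⟩ := exists_germ_eq e.open_source hξ hs
    change augmentation A (ξ.evalGerm fun y => e y i) = e ξ.base i
    rw [ξ.evalGerm_eq g hg, augmentation_eq_of_sub_mem _ _ (ξ.sub_mem g)]
    exact hg.self_of_nhds
  change WithLp.toLp 2 (fun i => augmentation A (ξ.coord e i)) ∈ e.target
  rw [key]
  exact e.map_source hξ

/-- A function on `M^A` with values in a finite-dimensional real vector space is smooth if, for
every chart `U` of `M`, it is on `U^A` a smooth function of the coordinates
`(ξ(x₁), …, ξ(xₙ))`, which range over an open subset of `A^n`. -/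
def IsSmooth {W : Type*} [AddCommGroup W] [Module ℝ W] [Module.Finite ℝ W]
    (φ : NearPoint n M A → W) : Prop :=
  ∀ e ∈ IsManifold.maximalAtlas (𝓡 n) ∞ M, ∃ G : (Fin n → A) → W,
    IsSmoothOn G (coordTarget A e) ∧
      ∀ ξ : NearPoint n M A, ξ.base ∈ e.source → φ ξ = G (ξ.coord e)

variable (n M A) in
/-- The `A`-algebra `C^∞(M^A, A)`. -/
def smoothFunctions : Subalgebra A (NearPoint n M A → A) where
  carrier := {φ | IsSmooth φ}
  mul_mem' {φ ψ} hφ hψ e he := by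
    obtain ⟨G, hG, hφG⟩ := hφ e he
    obtain ⟨H, hH, hψH⟩ := hψ e he
    exact ⟨fun v => G v * H v, hG.mul hH, fun ξ hξ => by
      rw [Pi.mul_apply, hφG ξ hξ, hψH ξ hξ]⟩
  add_mem' {φ ψ} hφ hψ e he := by
    obtain ⟨G, hG, hφG⟩ := hφ e he
    obtain ⟨H, hH, hψH⟩ := hψ e he
    exact ⟨fun v => G v + H v, hG.add hH, fun ξ hξ => by
      rw [Pi.add_apply, hφG ξ hξ, hψH ξ hξ]⟩
  algebraMap_mem' a _ _ := ⟨fun _ => a, IsSmoothOn.const a _, fun _ _ => rfl⟩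

variable (n M A) in
/-- The subset `C^∞(M^A)` of `C^∞(M^A, A)`: the smooth functions with values in `ℝ ⊆ A`. -/
def realFunctions : Set (smoothFunctions n M A) :=
  {φ | ∃ ψ : NearPoint n M A → ℝ, IsSmooth ψ ∧ ∀ ξ, φ.1 ξ = algebraMap ℝ A (ψ ξ)}

/-- The `A`-linear derivation `D` of `C^∞(M^A, A)` preserves `C^∞(M^A)` and extends the
prolongation `[θ]^A : g ↦ (θ g)^A` of the map `θ : C^∞(M) → C^∞(M)`. -/
def IsExtension (θ : C^∞⟮𝓡 n, M; ℝ⟯ → C^∞⟮𝓡 n, M; ℝ⟯)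
    (D : Derivation A (smoothFunctions n M A) (smoothFunctions n M A)) : Prop :=
  (∀ φ ∈ realFunctions n M A, D φ ∈ realFunctions n M A) ∧
    ∀ (g : C^∞⟮𝓡 n, M; ℝ⟯) (φ : smoothFunctions n M A), φ.1 = prolong g → (D φ).1 = prolong (θ g)

variable (n M A) in
/-- The skew-symmetric real multilinear forms of degree `p` from `C^∞(M)` into `C^∞(M^A, A)`. -/
abbrev Cochain (p : ℕ) : Type _ :=
  C^∞⟮𝓡 n, M; ℝ⟯ [⋀^Fin p]→ₗ[ℝ] smoothFunctions n M A

/-- The terms with a bracket in the cohomology operator. With indices counted from `0` this is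
`∑_{i < j} (-1)^(i+j) Ω({f_i, f_j}, f_0, …, omit f_i, …, omit f_j, …, f_p)`. -/
noncomputable def bracketTerms (P : PoissonBracket n M) : (p : ℕ) → Cochain n M A p →
    (Fin (p + 1) → C^∞⟮𝓡 n, M; ℝ⟯) → smoothFunctions n M A
  | 0, _, _ => 0
  | _ + 1, Ω, f => ∑ j, ∑ i, if Fin.castSucc i < j then
      (-1 : ℤ) ^ ((i : ℕ) + (j : ℕ)) •
        Ω (Fin.cons (P.bracket (f i.castSucc) (f j)) (i.removeNth (j.removeNth f)))
      else 0

/-- The value on `(f_0, …, f_p)` of the coboundary of `Ω`, for a map `ρ` from `C^∞(M)` into the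
`A`-linear derivations of `C^∞(M^A, A)`. -/
noncomputable def coboundary (P : PoissonBracket n M)
    (ρ : C^∞⟮𝓡 n, M; ℝ⟯ → Derivation A (smoothFunctions n M A) (smoothFunctions n M A))
    {p : ℕ} (Ω : Cochain n M A p) (f : Fin (p + 1) → C^∞⟮𝓡 n, M; ℝ⟯) : smoothFunctions n M A :=
  (∑ i : Fin (p + 1), (-1 : ℤ) ^ (i : ℕ) • ρ (f i) (Ω (i.removeNth f))) + bracketTerms P p Ω f

end Manifold

end WeilBundle

/-!
A vector field `θ` on `M` prolongs to a vector field on `M^A` whose components in the coordinates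
`(ξ(x₁), …, ξ(xₙ)) ∈ A^n` are the functions `(θ xᵢ)^A`; differentiating `A`-valued functions along
it gives the derivation in question for `θ = ad(f)`.

**Coordinates.** A smooth function of `n` variables has a Taylor expansion about a variable point
`x` whose coefficients are smooth in `x` and whose remainder is a combination of monomials of
degree `K` in `y - x` with smooth coefficients (`exists_taylor_expansion`, from Hadamard's lemma).
The maximal ideal of `A` is nilpotent, so a near point kills the remainder for large `K`, and `ξ(g)`
is a Taylor polynomial of `g` evaluated on the nilpotent parts of the coordinates of `ξ`
(`exists_toAlgHom_eq_sum`). Hence `g^A` is smooth and the coordinates determine `ξ`. Conversely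
every vector with augmentation in the chart comes from a near point (`exists_coord_eq`): a
polynomial vanishing to order `K` at the origin has no terms of degree less than `K`, so that
evaluating Taylor polynomials on nilpotent vectors is a well defined homomorphism.

**Existence.** The vector field `θ` acts on a smooth function `φ` by the derivative at `ξ`, in the
coordinates of a chart, in the direction `(ξ(θ x₁), …, ξ(θ xₙ))`. For `φ = g^A` the result is
`ξ(θ g)`, because both expressions are derivations along `ξ` with the same values on the `xᵢ`, and
such derivations agree by the Taylor expansion (`NearPoint.derivation_eq_zero`). Independence of the
chart is the same identity for the coordinate functions of another chart, by the chain rule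
(`dirDeriv_inChart_eq`).

**Uniqueness.** The difference `Δ` of two extensions kills every `g^A`. As `Δ` preserves real
functions, it kills the real components of `g^A` in a basis of `A`, in particular all real linear
coordinates of `M^A`; Hadamard's lemma on `A^n` and a bump function then give `Δ = 0`
(`derivation_eq_zero`).

Linearity and compatibility with brackets of `f ↦ [ad(f)]^A` follow from uniqueness. The cohomology
operator is the Chevalley–Eilenberg differential of this representation. It satisfies Cartan's
formula `ι_x d + d ι_x = L_x`, from which `[L_x, L_y] = L_{[x, y]}`, `[L_x, d] = 0` and `d² = 0`
follow by induction on the degree.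
-/

open scoped Manifold ContDiff Topology

-- the sections below share their instance arguments
set_option linter.unusedSectionVars false

/-! ### The Chevalley–Eilenberg differential -/

namespace ChevalleyEilenberg

open AlternatingMap

variable {L N : Type*} [AddCommGroup L] [Module ℝ L] [AddCommGroup N] [Module ℝ N] {p : ℕ}

/-- The insertion `ι_x Ω = Ω(x, ·, …, ·)` of a vector into the first slot of a form. -/
abbrev insertion (x : L) : (L [⋀^Fin (p + 1)]→ₗ[ℝ] N) →ₗ[ℝ] L [⋀^Fin p]→ₗ[ℝ] N :=
  curryLeftLinearMap.flip x

theorem ext_insertion {Ω Ω' : L [⋀^Fin (p + 1)]→ₗ[ℝ] N}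
    (h : ∀ x, insertion x Ω = insertion x Ω') : Ω = Ω' := by
  ext v
  have := congrArg (fun F => F (Matrix.vecTail v)) (h (v 0))
  change Ω (Matrix.vecCons (Matrix.vecHead v) (Matrix.vecTail v)) =
    Ω' (Matrix.vecCons (Matrix.vecHead v) (Matrix.vecTail v)) at this
  rwa [Matrix.cons_head_tail] at this

theorem insertion_alternatize_zero (F : L →ₗ[ℝ] L [⋀^Fin 0]→ₗ[ℝ] N) (x : L) :
    insertion x (alternatizeUncurryFinLM F) = F x := by
  ext v
  change alternatizeUncurryFin F (Matrix.vecCons x v) = _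
  rw [alternatizeUncurryFin_apply]
  simp [Matrix.vecCons]

theorem insertion_alternatize (F : L →ₗ[ℝ] L [⋀^Fin (p + 1)]→ₗ[ℝ] N) (x : L) :
    insertion x (alternatizeUncurryFinLM F) =
      F x - alternatizeUncurryFinLM (insertion x ∘ₗ F) := by
  ext v
  change alternatizeUncurryFin F (Matrix.vecCons x v) =
    F x v - alternatizeUncurryFin (insertion x ∘ₗ F) v
  rw [alternatizeUncurryFin_apply, alternatizeUncurryFin_apply, Fin.sum_univ_succ, sub_eq_add_neg,
    ← Finset.sum_neg_distrib]
  congr 1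
  · simp [Matrix.vecCons]
  · refine Finset.sum_congr rfl fun i _ => ?_
    have h1 : i.succ.removeNth (Matrix.vecCons x v) = Matrix.vecCons x (i.removeNth v) := by
      ext j
      refine Fin.cases ?_ (fun j => ?_) j <;> simp [Fin.removeNth, Matrix.vecCons]
    rw [h1, Fin.val_succ, pow_succ, mul_neg, mul_one, neg_smul]
    rfl

theorem insertion_comm (Ω : L [⋀^Fin (p + 2)]→ₗ[ℝ] N) (x y : L) :
    insertion y (insertion x Ω) = -insertion x (insertion y Ω) := by
  change (Ω.curryLeft x).curryLeft y = -(Ω.curryLeft y).curryLeft x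
  have h := curryLeft_same Ω (x + y)
  simp only [map_add, curryLeft_add, LinearMap.add_apply, curryLeft_same, zero_add, add_zero] at h
  exact eq_neg_of_add_eq_zero_right h

variable (br : L →ₗ[ℝ] L →ₗ[ℝ] L) (ρ : L →ₗ[ℝ] N →ₗ[ℝ] N)

/-- The map `x ↦ ρ(x) ∘ Ω`. -/
def action : (L [⋀^Fin p]→ₗ[ℝ] N) →ₗ[ℝ] L →ₗ[ℝ] L [⋀^Fin p]→ₗ[ℝ] N where
  toFun Ω :=
    { toFun x := (ρ x).compAlternatingMap Ω
      map_add' x y := by ext; simp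
      map_smul' c x := by ext; simp }
  map_add' _ _ := by ext; simp
  map_smul' _ _ := by ext; simp

/-- The bilinear map `(x, y) ↦ ι_{[x, y]} Ω`. -/
def bracketInsertion :
    (L [⋀^Fin (p + 1)]→ₗ[ℝ] N) →ₗ[ℝ] L →ₗ[ℝ] L →ₗ[ℝ] L [⋀^Fin p]→ₗ[ℝ] N where
  toFun Ω := br.compr₂ Ω.curryLeft
  map_add' _ _ := rfl
  map_smul' _ _ := rfl

/-- The Chevalley–Eilenberg differential of a bilinear operation `br` and a linear map `ρ`. The
terms with a bracket are obtained by antisymmetrizing `(x, y) ↦ ι_{[x, y]} Ω` over all ordered pairs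
of arguments, which counts every unordered pair twice. -/
noncomputable def differential :
    (p : ℕ) → (L [⋀^Fin p]→ₗ[ℝ] N) →ₗ[ℝ] L [⋀^Fin (p + 1)]→ₗ[ℝ] N
  | 0 => alternatizeUncurryFinLM ∘ₗ action ρ
  | _ + 1 => alternatizeUncurryFinLM ∘ₗ action ρ -
      (1 / 2 : ℝ) • alternatizeUncurryFinLM ∘ₗ
        (LinearMap.compRight ℝ alternatizeUncurryFinLM ∘ₗ bracketInsertion br)

/-- The Lie derivative `L_x Ω = ρ(x) ∘ Ω - ∑ i, Ω(…, [x, f_i], …)`. The sum is written as the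
antisymmetrization of `y ↦ ι_{[x, y]} Ω`. -/
noncomputable def lieDerivative (x : L) :
    (p : ℕ) → (L [⋀^Fin p]→ₗ[ℝ] N) →ₗ[ℝ] L [⋀^Fin p]→ₗ[ℝ] N
  | 0 => (action ρ).flip x
  | _ + 1 => (action ρ).flip x -
      alternatizeUncurryFinLM ∘ₗ (bracketInsertion br).flip x

theorem insertion_differential_zero (Ω : L [⋀^Fin 0]→ₗ[ℝ] N) (x : L) :
    insertion x (differential br ρ 0 Ω) = lieDerivative br ρ x 0 Ω :=
  insertion_alternatize_zero _ _

theorem insertion_action (Ω : L [⋀^Fin (p + 1)]→ₗ[ℝ] N) (x : L) :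
    insertion x ∘ₗ action ρ Ω = action ρ (insertion x Ω) := rfl

theorem lieDerivative_succ (Ω : L [⋀^Fin (p + 1)]→ₗ[ℝ] N) (x : L) :
    lieDerivative br ρ x (p + 1) Ω =
      action ρ Ω x - alternatizeUncurryFinLM (bracketInsertion br Ω x) := rfl

theorem differential_succ (Ω : L [⋀^Fin (p + 1)]→ₗ[ℝ] N) :
    differential br ρ (p + 1) Ω = alternatizeUncurryFinLM (action ρ Ω) -
      (1 / 2 : ℝ) • alternatizeUncurryFinLM
        (alternatizeUncurryFinLM ∘ₗ bracketInsertion br Ω) := rfl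

variable {br ρ}

theorem bracket_skew (hself : ∀ x, br x x = 0) (x y : L) : br y x = -br x y := by
  have h := hself (x + y)
  simp only [map_add, LinearMap.add_apply, hself, zero_add, add_zero] at h
  exact eq_neg_of_add_eq_zero_left h

/-- Cartan's formula `ι_x d + d ι_x = L_x`. -/
theorem insertion_differential (hself : ∀ x, br x x = 0) (Ω : L [⋀^Fin (p + 1)]→ₗ[ℝ] N) (x : L) :
    insertion x (differential br ρ (p + 1) Ω) =
      lieDerivative br ρ x (p + 1) Ω - differential br ρ p (insertion x Ω) := by
  have hT : (bracketInsertion br Ω).flip x = -bracketInsertion br Ω x := by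
    ext1 y
    change insertion (br y x) Ω = -insertion (br x y) Ω
    rw [bracket_skew hself]
    exact map_neg Ω.curryLeft _
  rw [differential_succ, lieDerivative_succ, map_sub, map_smul, insertion_alternatize,
    insertion_alternatize, insertion_action]
  have half : ∀ X : L [⋀^Fin (p + 1)]→ₗ[ℝ] N, (1 / 2 : ℝ) • X + (1 / 2 : ℝ) • X = X := fun X => by
    rw [← add_smul]; norm_num
  cases p with
  | zero =>
    have h2 : insertion x ∘ₗ alternatizeUncurryFinLM ∘ₗ bracketInsertion br Ω =
        (bracketInsertion br Ω).flip x := by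
      ext1 y
      exact insertion_alternatize_zero _ _
    have h3 : differential br ρ 0 (insertion x Ω) =
      alternatizeUncurryFinLM (action ρ (insertion x Ω)) := rfl
    rw [h2, hT, h3, LinearMap.comp_apply, map_neg, sub_neg_eq_add, smul_add, half]
    abel
  | succ p =>
    have h4 : ∀ y, insertion x ∘ₗ bracketInsertion br Ω y =
        -bracketInsertion br (insertion x Ω) y := fun y => by
      ext1 z
      exact insertion_comm _ _ _
    have h2 : insertion x ∘ₗ alternatizeUncurryFinLM ∘ₗ bracketInsertion br Ω =
        (bracketInsertion br Ω).flip x +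
          alternatizeUncurryFinLM ∘ₗ bracketInsertion br (insertion x Ω) := by
      ext1 y
      refine (insertion_alternatize _ _).trans ?_
      rw [h4, map_neg, sub_neg_eq_add]
      rfl
    rw [h2, hT, differential_succ, LinearMap.comp_apply, map_add, map_neg]
    have := half (alternatizeUncurryFinLM (bracketInsertion br Ω x))
    rw [sub_add_eq_sub_sub, sub_neg_eq_add, smul_sub, smul_add]
    nth_rewrite 3 [← this]
    abel

/-- The commutation rule `[L_x, ι_y] = ι_{[x, y]}`. -/
theorem insertion_lieDerivative (Ω : L [⋀^Fin (p + 1)]→ₗ[ℝ] N) (x y : L) :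
    insertion y (lieDerivative br ρ x (p + 1) Ω) =
      lieDerivative br ρ x p (insertion y Ω) - insertion (br x y) Ω := by
  rw [lieDerivative_succ, map_sub]
  cases p with
  | zero =>
    rw [insertion_alternatize_zero]
    rfl
  | succ p =>
    have h4 : insertion y ∘ₗ bracketInsertion br Ω x =
        -bracketInsertion br (insertion y Ω) x := by
      ext1 z
      exact insertion_comm _ _ _
    rw [insertion_alternatize, h4, map_neg, lieDerivative_succ, sub_neg_eq_add]
    change action ρ (insertion y Ω) x - (insertion (br x y) Ω + _) = _
    abel

/-- `[L_x, L_y] = L_{[x, y]}`, by induction on the degree: both sides have the same commutator with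
every `ι_z`. -/
theorem lieDerivative_bracket
    (hJ : ∀ x y z, br (br x y) z = br x (br y z) - br y (br x z))
    (hρ : ∀ x y m, ρ (br x y) m = ρ x (ρ y m) - ρ y (ρ x m)) (x y : L) :
    ∀ (p : ℕ) (Ω : L [⋀^Fin p]→ₗ[ℝ] N), lieDerivative br ρ (br x y) p Ω =
      lieDerivative br ρ x p (lieDerivative br ρ y p Ω) -
        lieDerivative br ρ y p (lieDerivative br ρ x p Ω)
  | 0, Ω => by
    ext v
    exact hρ x y (Ω v)
  | p + 1, Ω => by
    refine ext_insertion fun z => ?_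
    have hz : insertion (br (br x y) z) Ω =
        insertion (br x (br y z)) Ω - insertion (br y (br x z)) Ω := by
      rw [hJ]
      exact map_sub Ω.curryLeft _ _
    simp only [insertion_lieDerivative, map_sub, lieDerivative_bracket hJ hρ x y p, hz]
    abel

/-- `[L_x, d] = 0`, by induction on the degree. -/
theorem lieDerivative_differential (hself : ∀ x, br x x = 0)
    (hJ : ∀ x y z, br (br x y) z = br x (br y z) - br y (br x z))
    (hρ : ∀ x y m, ρ (br x y) m = ρ x (ρ y m) - ρ y (ρ x m)) (x : L) :
    ∀ (p : ℕ) (Ω : L [⋀^Fin p]→ₗ[ℝ] N), lieDerivative br ρ x (p + 1) (differential br ρ p Ω) =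
      differential br ρ p (lieDerivative br ρ x p Ω)
  | 0, Ω => by
    refine ext_insertion fun y => ?_
    rw [insertion_lieDerivative, insertion_differential_zero, insertion_differential_zero,
      insertion_differential_zero, lieDerivative_bracket hJ hρ]
    abel
  | p + 1, Ω => by
    refine ext_insertion fun y => ?_
    simp only [insertion_lieDerivative, insertion_differential hself, map_sub,
      lieDerivative_differential hself hJ hρ x p, lieDerivative_bracket hJ hρ]
    abel

/-- `d² = 0`: by Cartan's formula `ι_x d² = [L_x, d] + d² ι_x`, and both terms vanish by induction
on the degree. -/
theorem differential_differential (hself : ∀ x, br x x = 0)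
    (hJ : ∀ x y z, br (br x y) z = br x (br y z) - br y (br x z))
    (hρ : ∀ x y m, ρ (br x y) m = ρ x (ρ y m) - ρ y (ρ x m)) :
    ∀ (p : ℕ) (Ω : L [⋀^Fin p]→ₗ[ℝ] N), differential br ρ (p + 1) (differential br ρ p Ω) = 0
  | 0, Ω => by
    refine ext_insertion fun x => ?_
    rw [insertion_differential hself, insertion_differential_zero,
      lieDerivative_differential hself hJ hρ, sub_self, LinearMap.map_zero]
  | p + 1, Ω => by
    refine ext_insertion fun x => ?_
    rw [insertion_differential hself, insertion_differential hself, map_sub,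
      lieDerivative_differential hself hJ hρ, differential_differential hself hJ hρ p, sub_zero,
      sub_self, LinearMap.map_zero]

theorem differential_zero_apply (Ω : L [⋀^Fin 0]→ₗ[ℝ] N) (v : Fin 1 → L) :
    differential br ρ 0 Ω v =
      ∑ i : Fin 1, (-1 : ℤ) ^ (i : ℕ) • ρ (v i) (Ω (i.removeNth v)) :=
  alternatizeUncurryFin_apply _ _

theorem differential_succ_apply (hself : ∀ x, br x x = 0) (Ω : L [⋀^Fin (p + 1)]→ₗ[ℝ] N)
    (v : Fin (p + 2) → L) :
    differential br ρ (p + 1) Ω v =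
      (∑ i : Fin (p + 2), (-1 : ℤ) ^ (i : ℕ) • ρ (v i) (Ω (i.removeNth v))) +
        ∑ j : Fin (p + 2), ∑ i : Fin (p + 1), if Fin.castSucc i < j then
          (-1 : ℤ) ^ ((i : ℕ) + (j : ℕ)) •
            Ω (Fin.cons (br (v i.castSucc) (v j)) (i.removeNth (j.removeNth v)))
          else 0 := by
  have h1 := alternatizeUncurryFin_alternatizeUncurryFinLM_comp_apply (bracketInsertion br Ω) v
  have h2 : ∀ x y (w : Fin p → L), bracketInsertion br Ω x y w - bracketInsertion br Ω y x w =
      (2 : ℝ) • Ω (Fin.cons (br x y) w) := fun x y w => by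
    have h3 : bracketInsertion br Ω y x = -bracketInsertion br Ω x y := by
      change Ω.curryLeft (br y x) = -Ω.curryLeft (br x y)
      rw [bracket_skew hself, map_neg]
    rw [h3, AlternatingMap.neg_apply, sub_neg_eq_add, two_smul]
    rfl
  have h4 : differential br ρ (p + 1) Ω v = alternatizeUncurryFin (action ρ Ω) v - (1 / 2 : ℝ) •
      alternatizeUncurryFin (alternatizeUncurryFinLM ∘ₗ bracketInsertion br Ω) v := rfl
  rw [h4, h1, alternatizeUncurryFin_apply, sub_eq_add_neg]
  congr 1
  rw [Finset.smul_sum, ← Finset.sum_neg_distrib, Finset.sum_comm]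
  refine Finset.sum_congr rfl fun i _ => ?_
  rw [Fin.sum_univ_succ, if_neg (Fin.not_lt_zero _), zero_add, Finset.smul_sum,
    ← Finset.sum_neg_distrib, ← Finset.sum_filter]
  refine Finset.sum_congr ?_ fun j hj => ?_
  · ext j
    simp [Fin.castSucc_lt_succ_iff]
  · have hj' : i ≤ j := by simpa using hj
    have H : i.removeNth (j.succ.removeNth v) = j.removeNth (i.castSucc.removeNth v) := by
      rw [Fin.removeNth_removeNth_eq_swap]
      simp [Fin.predAbove, hj', Fin.succAbove]
    rw [h2, H, smul_comm, smul_smul, Fin.val_succ, ← add_assoc, pow_succ]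
    norm_num

end ChevalleyEilenberg

/-! ### Hadamard's lemma and Taylor expansions -/

namespace WeilBundle

section Hadamard

universe u

theorem contDiff_fderiv_comp_inl {V : Type u} {F : Type u} [NormedAddCommGroup V] [NormedSpace ℝ V]
    [NormedAddCommGroup F] [NormedSpace ℝ F] {f : V × ℝ → F} (hf : ContDiff ℝ ∞ f) :
    ContDiff ℝ ∞ fun q : V × ℝ => (fderiv ℝ f q).comp (ContinuousLinearMap.inl ℝ V ℝ) :=
  (hf.fderiv_right (m := ∞) (by simp)).clm_comp contDiff_const

theorem hasFDerivAt_intervalIntegral {V : Type u} {F : Type u} [NormedAddCommGroup V]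
    [NormedSpace ℝ V] [FiniteDimensional ℝ V] [NormedAddCommGroup F] [NormedSpace ℝ F]
    [CompleteSpace F] {f : V × ℝ → F} (hf : ContDiff ℝ ∞ f) (x : V) :
    HasFDerivAt (fun x => ∫ t in (0 : ℝ)..1, f (x, t))
      (∫ t in (0 : ℝ)..1, (fderiv ℝ f (x, t)).comp (ContinuousLinearMap.inl ℝ V ℝ)) x := by
  have hc := (contDiff_fderiv_comp_inl hf).continuous
  obtain ⟨C, hC⟩ := ((isCompact_closedBall x 1).prod
    (isCompact_Icc (a := (0 : ℝ)) (b := 1))).exists_bound_of_continuousOn hc.continuousOn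
  refine (intervalIntegral.hasFDerivAt_integral_of_dominated_of_fderiv_le
    (μ := MeasureTheory.volume) (F := fun x t => f (x, t)) (bound := fun _ => C)
    (F' := fun x t => (fderiv ℝ f (x, t)).comp (ContinuousLinearMap.inl ℝ V ℝ))
    (Metric.closedBall_mem_nhds x one_pos) ?_ ?_ ?_ ?_ ?_ ?_)
  · exact Filter.Eventually.of_forall fun y =>
      (hf.continuous.comp (by fun_prop : Continuous fun t : ℝ => (y, t))).aestronglyMeasurable
  · exact (hf.continuous.comp (by fun_prop : Continuous fun t : ℝ => (x, t))).intervalIntegrable _ _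
  · exact (hc.comp (by fun_prop : Continuous fun t : ℝ => (x, t))).aestronglyMeasurable
  · refine Filter.Eventually.of_forall fun t ht y hy => hC (y, t) ⟨hy, ?_⟩
    rw [Set.uIoc_of_le zero_le_one] at ht
    exact ⟨ht.1.le, ht.2⟩
  · exact intervalIntegrable_const
  · refine Filter.Eventually.of_forall fun t ht y hy => ?_
    exact (hf.differentiable (by simp) (y, t)).hasFDerivAt.comp y
      (hasFDerivAt_prodMk_left y t)

theorem contDiff_intervalIntegral {V : Type u} [NormedAddCommGroup V]
    [NormedSpace ℝ V] [FiniteDimensional ℝ V] {F : Type u} [NormedAddCommGroup F] [NormedSpace ℝ F]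
    [CompleteSpace F] {f : V × ℝ → F} (hf : ContDiff ℝ ∞ f) :
    ContDiff ℝ ∞ (fun x => ∫ t in (0 : ℝ)..1, f (x, t)) := by
  refine contDiff_infty.mpr fun k => ?_
  induction k generalizing F with
  | zero =>
    rw [Nat.cast_zero, contDiff_zero]
    exact continuous_iff_continuousAt.mpr fun x => (hasFDerivAt_intervalIntegral hf x).continuousAt
  | succ k ih =>
    have h : fderiv ℝ (fun x => ∫ t in (0 : ℝ)..1, f (x, t)) = fun x =>
        ∫ t in (0 : ℝ)..1, (fderiv ℝ f (x, t)).comp (ContinuousLinearMap.inl ℝ V ℝ) :=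
      funext fun x => (hasFDerivAt_intervalIntegral hf x).fderiv
    rw [Nat.cast_succ, contDiff_succ_iff_fderiv]
    refine ⟨fun x => (hasFDerivAt_intervalIntegral hf x).differentiableAt, by simp, ?_⟩
    rw [h]
    exact ih (contDiff_fderiv_comp_inl hf)

/-- Hadamard's lemma: a smooth function satisfies `f y - f x = h(x, y)(y - x)` with `h` smooth in
both points, namely `h(x, y) = ∫₀¹ Df(x + t(y - x)) dt`. -/
theorem exists_sub_eq_clm_apply {V F : Type u} [NormedAddCommGroup V]
    [NormedSpace ℝ V] [FiniteDimensional ℝ V] [NormedAddCommGroup F] [NormedSpace ℝ F]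
    [CompleteSpace F] {f : V → F} (hf : ContDiff ℝ ∞ f) :
    ∃ h : V × V → V →L[ℝ] F, ContDiff ℝ ∞ h ∧ ∀ x y, f y - f x = h (x, y) (y - x) := by
  have hf' : ContDiff ℝ ∞ (fderiv ℝ f) := hf.fderiv_right (by simp)
  refine ⟨fun q => ∫ t in (0 : ℝ)..1, fderiv ℝ f (q.1 + t • (q.2 - q.1)), ?_, fun x y => ?_⟩
  · exact contDiff_intervalIntegral (f := fun q : (V × V) × ℝ =>
      fderiv ℝ f (q.1.1 + q.2 • (q.1.2 - q.1.1))) (hf'.comp (by fun_prop))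
  · have hc : Continuous fun t : ℝ => fderiv ℝ f (x + t • (y - x)) :=
      hf'.continuous.comp (by fun_prop)
    have h1 : ∀ t ∈ Set.uIcc (0 : ℝ) 1, HasDerivAt (fun t : ℝ => f (x + t • (y - x)))
        (fderiv ℝ f (x + t • (y - x)) (y - x)) t := fun t _ => by
      have h2 : HasDerivAt (fun t : ℝ => x + t • (y - x)) (y - x) t := by
        simpa using ((hasDerivAt_id t).smul_const (y - x)).const_add x
      exact ((hf.differentiable (by simp) _).hasFDerivAt).comp_hasDerivAt t h2
    have h3 := intervalIntegral.integral_eq_sub_of_hasDerivAt h1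
      ((hc.clm_apply continuous_const).intervalIntegrable (μ := MeasureTheory.volume) _ _)
    simp only [one_smul, zero_smul, add_zero, add_sub_cancel] at h3
    rw [← h3]
    exact (ContinuousLinearMap.intervalIntegral_apply
      (hc.intervalIntegrable (μ := MeasureTheory.volume) _ _) _).symm

/-- A function that is smooth on an open set has the germ of a globally smooth function at every
point of this set. -/
theorem exists_contDiff_eventuallyEq {V F : Type*} [NormedAddCommGroup V]
    [NormedSpace ℝ V] [FiniteDimensional ℝ V] [NormedAddCommGroup F] [NormedSpace ℝ F]
    {f : V → F} {s : Set V} (hs : IsOpen s) (hf : ContDiffOn ℝ ∞ f s) {x : V} (hx : x ∈ s) :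
    ∃ g : V → F, ContDiff ℝ ∞ g ∧ g =ᶠ[𝓝 x] f := by
  obtain ⟨ε, hε, hεs⟩ := Metric.isOpen_iff.mp hs x hx
  let χ : ContDiffBump x := ⟨ε / 4, ε / 2, by positivity, by linarith⟩
  refine ⟨fun y => χ y • f y, ?_, ?_⟩
  · refine contMDiff_iff_contDiff.mp (contMDiff_of_tsupport fun y hy => ?_)
    have hy' : y ∈ s := by
      have := tsupport_smul_subset_left (χ : V → ℝ) f hy
      rw [χ.tsupport_eq] at this
      exact hεs (Metric.closedBall_subset_ball (by change ε / 2 < ε; linarith) this)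
    exact (χ.contDiffAt.smul (hf.contDiffAt (hs.mem_nhds hy'))).contMDiffAt
  · filter_upwards [χ.eventuallyEq_one] with y hy
    rw [hy, Pi.one_apply, one_smul]

open MvPolynomial in
/-- The Taylor expansion about `x` of a smooth function `f(x, ·)` that itself depends on `x`, as a
finite sum with unspecified index types: the coefficients `c i` are smooth in `x`, the coefficients
`r j` of the remainder are smooth in both points, and the polynomials `q j` have no terms
of degree less than `K`. The dependence of `f` on `x` is what makes the induction on `K` work:
Hadamard's lemma is applied to the `r j`. -/
theorem exists_taylor_expansion {n : ℕ} (K : ℕ)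
    {f : EuclideanSpace ℝ (Fin n) × EuclideanSpace ℝ (Fin n) → ℝ} (hf : ContDiff ℝ ∞ f) :
    ∃ (ι κ : Type) (_ : Fintype ι) (_ : Fintype κ) (c : ι → EuclideanSpace ℝ (Fin n) → ℝ)
      (p : ι → MvPolynomial (Fin n) ℝ)
      (r : κ → EuclideanSpace ℝ (Fin n) × EuclideanSpace ℝ (Fin n) → ℝ)
      (q : κ → MvPolynomial (Fin n) ℝ),
      (∀ i, ContDiff ℝ ∞ (c i)) ∧ (∀ j, ContDiff ℝ ∞ (r j)) ∧
      (∀ j, q j ∈ idealOfVars (Fin n) ℝ ^ K) ∧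
      ∀ x y, f (x, y) =
        ∑ i, c i x * eval (⇑(y - x)) (p i) + ∑ j, r j (x, y) * eval (⇑(y - x)) (q j) := by
  induction K with
  | zero =>
    exact ⟨Empty, Unit, inferInstance, inferInstance, Empty.elim, Empty.elim, fun _ => f,
      fun _ => 1, fun i => i.elim, fun _ => hf, fun _ => by simp, fun x y => by simp⟩
  | succ K ih =>
    obtain ⟨ι, κ, _, _, c, p, r, q, hc, hr, hq, h⟩ := ih
    choose s hs hrs using fun j => exists_sub_eq_clm_apply (hr j)
    let b : Fin n → EuclideanSpace ℝ (Fin n) := fun k => EuclideanSpace.single k 1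
    refine ⟨ι ⊕ κ, κ × Fin n, inferInstance, inferInstance,
      Sum.elim c fun j x => r j (x, x), Sum.elim p q,
      fun j xy => s j.1 ((xy.1, xy.1), xy) (0, b j.2), fun j => q j.1 * X j.2, ?_, ?_, ?_, ?_⟩
    · rintro (i | j)
      · exact hc i
      · exact (hr j).comp (by fun_prop : ContDiff ℝ ∞ fun x => (x, x))
    · intro j
      exact ((hs j.1).comp (by fun_prop : ContDiff ℝ ∞ fun xy : EuclideanSpace ℝ (Fin n) ×
        EuclideanSpace ℝ (Fin n) => ((xy.1, xy.1), xy))).clm_apply contDiff_const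
    · intro j
      rw [pow_succ]
      exact Ideal.mul_mem_mul (hq j.1) (Ideal.subset_span ⟨_, rfl⟩)
    · intro x y
      rw [h, Fintype.sum_sum_type, add_assoc]
      simp only [Sum.elim_inl, Sum.elim_inr]
      congr 1
      rw [Fintype.sum_prod_type, ← Finset.sum_add_distrib]
      refine Finset.sum_congr rfl fun j _ => ?_
      have h1 := hrs j (x, x) (x, y)
      have h2 : ((x, y) - (x, x) : EuclideanSpace ℝ (Fin n) × EuclideanSpace ℝ (Fin n)) =
          ∑ k, (y - x) k • (0, b k) := by
        have : y - x = ∑ k, (y - x) k • b k := by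
          ext l
          simp [b, Pi.single_apply]
        calc (x, y) - (x, x) = LinearMap.inr ℝ (EuclideanSpace ℝ (Fin n)) _ (y - x) := by simp
          _ = _ := by
            conv_lhs => rw [this]
            simp only [map_sum, map_smul, LinearMap.inr_apply]
      rw [h2, map_sum] at h1
      rw [← sub_eq_iff_eq_add', ← sub_mul, h1, Finset.sum_mul]
      refine Finset.sum_congr rfl fun k _ => ?_
      rw [map_smul, smul_eq_mul, eval_mul, eval_X]
      ring

end Hadamard

/-! ### Calculus on finite-dimensional spaces without a norm -/

section CoordinateCalculus

variable {V W Z : Type*} [AddCommGroup V] [Module ℝ V] [Module.Finite ℝ V]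
  [AddCommGroup W] [Module ℝ W] [Module.Finite ℝ W] [AddCommGroup Z] [Module ℝ Z]
  [Module.Finite ℝ Z]

variable (V) in
/-- The linear coordinates of a finite-dimensional space in the basis used by `IsSmoothOn`. -/
noncomputable def linCoord : V ≃ₗ[ℝ] (Fin (Module.finrank ℝ V) → ℝ) :=
  (Module.finBasis ℝ V).equivFun

/-- The map `G` read in linear coordinates of `V` and `W`. -/
noncomputable def inCoord (G : V → W) (v : Fin (Module.finrank ℝ V) → ℝ) :
    Fin (Module.finrank ℝ W) → ℝ :=
  linCoord W (G ((linCoord V).symm v))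

/-- The neighbourhood filter of a point for the canonical topology of a finite-dimensional space
that carries no topology instance. -/
noncomputable def linNhds (a : V) : Filter V :=
  (𝓝 (linCoord V a)).map (linCoord V).symm

/-- Smoothness at a point for maps between finite-dimensional spaces without a norm. -/
def IsSmoothAt (G : V → W) (a : V) : Prop :=
  ContDiffAt ℝ ∞ (inCoord G) (linCoord V a)

/-- The derivative of `G` at `a` in the direction `v`, zero if `G` is not differentiable at `a`. -/
noncomputable def dirDeriv (G : V → W) (a v : V) : W :=
  (linCoord W).symm (fderiv ℝ (inCoord G) (linCoord V a) (linCoord V v))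

theorem eventually_linNhds {a : V} {p : V → Prop} :
    (∀ᶠ b in linNhds a, p b) ↔ ∀ᶠ v in 𝓝 (linCoord V a), p ((linCoord V).symm v) := Iff.rfl

theorem self_of_eventually_linNhds {a : V} {p : V → Prop} (h : ∀ᶠ b in linNhds a, p b) :
    p a := by
  simpa using (eventually_linNhds.mp h).self_of_nhds

theorem tendsto_linNhds_of_linearMap {F : Type*} [NormedAddCommGroup F] [NormedSpace ℝ F]
    (L : V →ₗ[ℝ] F) (a : V) : Filter.Tendsto L (linNhds a) (𝓝 (L a)) := by
  have h : Continuous (L ∘ₗ (linCoord V).symm.toLinearMap) :=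
    LinearMap.continuous_of_finiteDimensional _
  have h1 := h.tendsto (linCoord V a)
  simp only [LinearMap.comp_apply, LinearEquiv.coe_coe, LinearEquiv.symm_apply_apply] at h1
  exact Filter.tendsto_map'_iff.mpr h1

theorem inCoord_comp (H : W → Z) (G : V → W) :
    inCoord (fun v => H (G v)) = inCoord H ∘ inCoord G := by
  ext v : 1
  simp [inCoord]

theorem inCoord_linCoord (G : V → W) (a : V) : inCoord G (linCoord V a) = linCoord W (G a) := by
  simp [inCoord]

theorem inCoord_linearMap (L : V →ₗ[ℝ] W) : inCoord L = LinearMap.toContinuousLinearMap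
    ((linCoord W).toLinearMap ∘ₗ L ∘ₗ (linCoord V).symm.toLinearMap) := rfl

theorem inCoord_eventuallyEq {G H : V → W} {a : V} (h : G =ᶠ[linNhds a] H) :
    inCoord G =ᶠ[𝓝 (linCoord V a)] inCoord H := by
  filter_upwards [eventually_linNhds.mp h] with v hv
  rw [inCoord, hv, inCoord]

/-- The multiplication of `A` read in linear coordinates. -/
noncomputable def coordMul (A : Type*) [CommRing A] [Algebra ℝ A] [Module.Finite ℝ A] :
    (Fin (Module.finrank ℝ A) → ℝ) →L[ℝ] (Fin (Module.finrank ℝ A) → ℝ) →L[ℝ]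
      (Fin (Module.finrank ℝ A) → ℝ) :=
  LinearMap.toContinuousBilinearMap (((LinearMap.mul ℝ A).compl₁₂ (linCoord A).symm.toLinearMap
    (linCoord A).symm.toLinearMap).compr₂ (linCoord A).toLinearMap)

theorem coordMul_apply {A : Type*} [CommRing A] [Algebra ℝ A] [Module.Finite ℝ A]
    (x y : Fin (Module.finrank ℝ A) → ℝ) :
    coordMul A x y = linCoord A ((linCoord A).symm x * (linCoord A).symm y) := rfl

theorem inCoord_mul {A : Type*} [CommRing A] [Algebra ℝ A] [Module.Finite ℝ A] (G H : V → A) :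
    inCoord (fun v => G v * H v) = fun x => coordMul A (inCoord G x) (inCoord H x) := by
  ext x : 1
  simp [coordMul_apply, inCoord]

namespace IsSmoothAt

theorem congr {G H : V → W} {a : V} (hG : IsSmoothAt G a) (h : H =ᶠ[linNhds a] G) :
    IsSmoothAt H a :=
  ContDiffAt.congr_of_eventuallyEq hG (inCoord_eventuallyEq h)

theorem comp {H : W → Z} {G : V → W} {a : V} (hH : IsSmoothAt H (G a)) (hG : IsSmoothAt G a) :
    IsSmoothAt (fun v => H (G v)) a := by
  unfold IsSmoothAt
  rw [inCoord_comp]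
  exact ContDiffAt.comp _ (by rw [inCoord_linCoord]; exact hH) hG

theorem linearMap (L : V →ₗ[ℝ] W) (a : V) : IsSmoothAt L a := by
  unfold IsSmoothAt
  rw [inCoord_linearMap]
  exact (ContinuousLinearMap.contDiff _).contDiffAt

theorem const (w : W) (a : V) : IsSmoothAt (fun _ => w) a := contDiffAt_const

theorem add {G H : V → W} {a : V} (hG : IsSmoothAt G a) (hH : IsSmoothAt H a) :
    IsSmoothAt (fun v => G v + H v) a := by
  unfold IsSmoothAt at *
  convert ContDiffAt.add hG hH using 1
  ext v : 1
  simp [inCoord]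

theorem sum {ι : Type*} {s : Finset ι} {G : ι → V → W} {a : V} (h : ∀ i ∈ s, IsSmoothAt (G i) a) :
    IsSmoothAt (fun v => ∑ i ∈ s, G i v) a := by
  classical
  induction s using Finset.induction_on with
  | empty => simpa using const (0 : W) a
  | insert i s hi ih =>
    simp only [Finset.sum_insert hi]
    exact (h i (by simp)).add (ih fun j hj => h j (by simp [hj]))

theorem pi {ι : Type*} [Fintype ι] {G : V → ι → W} {a : V}
    (h : ∀ i, IsSmoothAt (fun v => G v i) a) :
    IsSmoothAt G a := by
  classical
  have : G = fun v => ∑ i, LinearMap.single ℝ (fun _ : ι => W) i (G v i) := by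
    ext v i
    simp [Finset.sum_apply, Pi.single_apply]
  rw [this]
  exact sum fun i _ => (linearMap _ _).comp (h i)

theorem isSmoothOn {G : V → W} {s : Set V} (h : ∀ a ∈ s, IsSmoothAt G a) : IsSmoothOn G s := by
  intro v hv
  have h1 := h _ hv
  have h2 : linCoord V ((Module.finBasis ℝ V).equivFun.symm v) = v :=
    (linCoord V).apply_symm_apply v
  unfold IsSmoothAt at h1
  rw [h2] at h1
  exact h1.contDiffWithinAt

theorem of_isSmoothOn {G : V → W} {s : Set V} {a : V} (h : IsSmoothOn G s)
    (hs : ∀ᶠ b in linNhds a, b ∈ s) : IsSmoothAt G a :=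
  ContDiffOn.contDiffAt h hs

/-- A map that is smooth near `a` agrees near `a` with a map that is smooth everywhere. Smoothness
at `a` alone would not suffice: it gives neighbourhoods of `C^k` smoothness that may shrink with
`k`. -/
theorem exists_eventuallyEq {G : V → W} {a : V} (h : ∀ᶠ b in linNhds a, IsSmoothAt G b) :
    ∃ H : V → W, (∀ b, IsSmoothAt H b) ∧ H =ᶠ[linNhds a] G := by
  obtain ⟨s, hs, hso, has⟩ := eventually_nhds_iff.mp (eventually_linNhds.mp h)
  have hG : ContDiffOn ℝ ∞ (inCoord G) s := fun v hv => by
    have := hs v hv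
    unfold IsSmoothAt at this
    rw [LinearEquiv.apply_symm_apply] at this
    exact this.contDiffWithinAt
  obtain ⟨g, hg, hgG⟩ := exists_contDiff_eventuallyEq hso hG has
  have hin : inCoord (fun v => (linCoord W).symm (g (linCoord V v))) = g := by
    ext v : 1
    simp [inCoord]
  refine ⟨fun v => (linCoord W).symm (g (linCoord V v)), fun b => ?_, ?_⟩
  · unfold IsSmoothAt
    rw [hin]
    exact hg.contDiffAt
  · refine eventually_linNhds.mpr ?_
    filter_upwards [hgG] with v hv
    simp [hv, inCoord]

theorem mul {A : Type*} [CommRing A] [Algebra ℝ A] [Module.Finite ℝ A]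
    {G H : V → A} {a : V} (hG : IsSmoothAt G a) (hH : IsSmoothAt H a) :
    IsSmoothAt (fun v => G v * H v) a := by
  unfold IsSmoothAt at *
  rw [inCoord_mul]
  exact ((coordMul A).contDiff.contDiffAt.comp _ hG).clm_apply hH

theorem dirDeriv {G v : V → _} {a : V} (hG : IsSmoothAt (W := W) G a) (hv : IsSmoothAt v a) :
    IsSmoothAt (fun b => WeilBundle.dirDeriv G b (v b)) a := by
  have : inCoord (fun b => WeilBundle.dirDeriv G b (v b)) =
      fun x => fderiv ℝ (inCoord G) x (inCoord v x) := by
    ext x : 1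
    simp [inCoord, WeilBundle.dirDeriv]
  unfold IsSmoothAt at *
  rw [this]
  exact (hG.fderiv_right (m := ∞) (by simp)).clm_apply hv

end IsSmoothAt

theorem dirDeriv_congr {G H : V → W} {a : V} (h : G =ᶠ[linNhds a] H) (v : V) :
    dirDeriv G a v = dirDeriv H a v := by
  rw [dirDeriv, (inCoord_eventuallyEq h).fderiv_eq, dirDeriv]

theorem IsSmoothAt.differentiableAt {G : V → W} {a : V} (h : IsSmoothAt G a) :
    DifferentiableAt ℝ (inCoord G) (linCoord V a) :=
  ContDiffAt.differentiableAt h (by simp)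

theorem dirDeriv_comp {H : W → Z} {G : V → W} {a : V} (hH : IsSmoothAt H (G a))
    (hG : IsSmoothAt G a) (v : V) :
    dirDeriv (fun b => H (G b)) a v = dirDeriv H (G a) (dirDeriv G a v) := by
  rw [dirDeriv, inCoord_comp, fderiv_comp _ (by rw [inCoord_linCoord]; exact hH.differentiableAt)
    hG.differentiableAt, inCoord_linCoord]
  simp [dirDeriv]

theorem dirDeriv_linearMap (L : V →ₗ[ℝ] W) (a v : V) : dirDeriv L a v = L v := by
  rw [dirDeriv, inCoord_linearMap, ContinuousLinearMap.fderiv]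
  simp

theorem dirDeriv_add {G H : V → W} {a : V} (hG : IsSmoothAt G a) (hH : IsSmoothAt H a) (v : V) :
    dirDeriv (fun b => G b + H b) a v = dirDeriv G a v + dirDeriv H a v := by
  have : inCoord (fun b => G b + H b) = inCoord G + inCoord H := by
    ext x : 1
    simp [inCoord]
  rw [dirDeriv, this, fderiv_add hG.differentiableAt hH.differentiableAt]
  simp [dirDeriv]

theorem dirDeriv_mul {A : Type*} [CommRing A] [Algebra ℝ A] [Module.Finite ℝ A]
    {G H : V → A} {a : V} (hG : IsSmoothAt G a) (hH : IsSmoothAt H a) (v : V) :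
    dirDeriv (fun b => G b * H b) a v = G a * dirDeriv H a v + H a * dirDeriv G a v := by
  rw [dirDeriv, inCoord_mul,
    (coordMul A).fderiv_of_bilinear hG.differentiableAt hH.differentiableAt]
  simp [coordMul_apply, inCoord_linCoord, dirDeriv, mul_comm]

/-- Hadamard's lemma in linear coordinates. -/
theorem exists_hadamard {H : V → W} (hH : ∀ b, IsSmoothAt H b) (a : V) :
    ∃ h : Fin (Module.finrank ℝ V) → V → W, (∀ k b, IsSmoothAt (h k) b) ∧
      ∀ b, H b - H a = ∑ k, linCoord V (b - a) k • h k b := by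
  have hH' : ContDiff ℝ ∞ (inCoord H) := contDiff_iff_contDiffAt.mpr fun v => by
    simpa [IsSmoothAt] using hH ((linCoord V).symm v)
  obtain ⟨h, hh, hsub⟩ := exists_sub_eq_clm_apply hH'
  refine ⟨fun k b => (linCoord W).symm (h (linCoord V a, linCoord V b) (Pi.single k 1)),
    fun k b => ?_, fun b => ?_⟩
  · have : inCoord (fun b => (linCoord W).symm (h (linCoord V a, linCoord V b) (Pi.single k 1))) =
        fun v => h (linCoord V a, v) (Pi.single k 1) := by
      ext v : 1
      simp [inCoord]
    unfold IsSmoothAt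
    rw [this]
    exact ((hh.comp (contDiff_prodMk_right _)).clm_apply contDiff_const).contDiffAt
  · apply (linCoord W).injective
    have h1 := hsub (linCoord V a) (linCoord V b)
    rw [inCoord_linCoord, inCoord_linCoord, ← map_sub, ← map_sub,
      pi_eq_sum_univ' (linCoord V (b - a))] at h1
    rw [h1]
    simp [map_sum]

end CoordinateCalculus

/-! ### Orders of vanishing of polynomials and nilpotency -/

section PolynomialOrder

open MvPolynomial Asymptotics

theorem polynomial_X_pow_dvd_of_isBigO {P : Polynomial ℝ} {K : ℕ}
    (h : (fun t : ℝ => P.eval t) =O[𝓝 0] fun t : ℝ => t ^ K) : Polynomial.X ^ K ∣ P := by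
  rcases eq_or_ne P 0 with rfl | hP
  · exact dvd_zero _
  obtain ⟨Q, hPQ, hQ⟩ := P.exists_eq_pow_rootMultiplicity_mul_and_not_dvd hP 0
  set m := P.rootMultiplicity 0
  rw [map_zero, sub_zero] at hPQ hQ
  by_cases hm : K ≤ m
  · rw [hPQ]
    exact (pow_dvd_pow _ hm).mul_right Q
  · refine absurd ?_ hQ
    rw [Polynomial.X_dvd_iff, Polynomial.coeff_zero_eq_eval_zero]
    obtain ⟨C, hC⟩ := h.bound
    -- off the origin the factor `t ^ m` can be cancelled, and `Q(t) = O(t)` follows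
    have h1 : ∀ᶠ t : ℝ in 𝓝[≠] 0, ‖Q.eval t‖ ≤ C * ‖t ^ (K - m)‖ := by
      filter_upwards [hC.filter_mono nhdsWithin_le_nhds, self_mem_nhdsWithin] with t ht ht0
      have hpos : 0 < ‖t ^ m‖ := norm_pos_iff.mpr (pow_ne_zero _ ht0)
      have hK : t ^ K = t ^ m * t ^ (K - m) := by rw [← pow_add]; congr 1; omega
      rw [hPQ, hK] at ht
      simp only [Polynomial.eval_mul, Polynomial.eval_pow, Polynomial.eval_X, norm_mul] at ht
      rw [mul_left_comm] at ht
      exact le_of_mul_le_mul_left ht hpos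
    have h2 : Filter.Tendsto (fun t : ℝ => C * ‖t ^ (K - m)‖) (𝓝[≠] 0) (𝓝 0) := by
      have : Continuous fun t : ℝ => C * ‖t ^ (K - m)‖ := by fun_prop
      have h3 := (this.tendsto 0).mono_left (nhdsWithin_le_nhds (s := {0}ᶜ))
      rwa [zero_pow (by omega), norm_zero, mul_zero] at h3
    have h4 := squeeze_zero_norm' h1 h2
    have h5 := (Q.continuous.tendsto 0).mono_left (nhdsWithin_le_nhds (s := {0}ᶜ))
    exact tendsto_nhds_unique h5 h4

variable {n : ℕ}

theorem isBigO_eval_of_mem_idealOfVars {p : MvPolynomial (Fin n) ℝ}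
    (hp : p ∈ idealOfVars (Fin n) ℝ) :
    (fun y : EuclideanSpace ℝ (Fin n) => eval (⇑y) p) =O[𝓝 0] fun y => ‖y‖ := by
  induction hp using Submodule.span_induction with
  | mem p hp =>
    obtain ⟨i, rfl⟩ := hp
    refine IsBigO.of_bound 1 (Filter.Eventually.of_forall fun y => ?_)
    simpa using PiLp.norm_apply_le y i
  | zero => simpa using isBigO_zero _ _
  | add p q _ _ hp hq => simpa using hp.add hq
  | smul r p _ hp =>
    have h1 : Continuous fun y : EuclideanSpace ℝ (Fin n) => eval (⇑y) r := by
      have := MvPolynomial.continuous_eval r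
      fun_prop
    simpa using (h1.continuousAt.isBigO_one ℝ).mul hp

theorem isBigO_eval_of_mem_pow {p : MvPolynomial (Fin n) ℝ} {K : ℕ}
    (hp : p ∈ idealOfVars (Fin n) ℝ ^ K) :
    (fun y : EuclideanSpace ℝ (Fin n) => eval (⇑y) p) =O[𝓝 0] fun y => ‖y‖ ^ K := by
  induction K generalizing p with
  | zero =>
    have h1 : Continuous fun y : EuclideanSpace ℝ (Fin n) => eval (⇑y) p := by
      have := MvPolynomial.continuous_eval p
      fun_prop
    simpa using h1.continuousAt.isBigO_one ℝ
  | succ K ih =>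
    rw [pow_succ] at hp
    refine Submodule.mul_induction_on hp (fun q hq r hr => ?_) fun q r hq hr => ?_
    · simpa [pow_succ] using (ih hq).mul (isBigO_eval_of_mem_idealOfVars hr)
    · simpa using hq.add hr

theorem eval_smul_eq_sum (p : MvPolynomial (Fin n) ℝ) (t : ℝ) (v : Fin n → ℝ) :
    eval (t • v) p =
      ∑ d ∈ Finset.range (p.totalDegree + 1), eval v (homogeneousComponent d p) * t ^ d := by
  conv_lhs => rw [← sum_homogeneousComponent p]
  rw [map_sum]
  refine Finset.sum_congr rfl fun d _ => ?_
  have h := homogeneousComponent_isHomogeneous d p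
  rw [eval_eq, eval_eq, Finset.sum_mul]
  refine Finset.sum_congr rfl fun s hs => ?_
  have h1 : ∑ i ∈ s.support, s i = d := by
    by_contra hne
    exact mem_support_iff.mp hs (h.coeff_eq_zero hne)
  simp only [Pi.smul_apply, smul_eq_mul, mul_pow, Finset.prod_mul_distrib]
  rw [Finset.prod_pow_eq_pow_sum, h1]
  ring

/-- A polynomial function that vanishes to order `K` at the origin has no terms of degree less
than `K`. -/
theorem mem_idealOfVars_pow_of_isBigO {p : MvPolynomial (Fin n) ℝ} {K : ℕ}
    (h : (fun y : EuclideanSpace ℝ (Fin n) => eval (⇑y) p) =O[𝓝 0] fun y => ‖y‖ ^ K) :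
    p ∈ idealOfVars (Fin n) ℝ ^ K := by
  have key : ∀ d < K, homogeneousComponent d p = 0 := fun d hd => by
    refine MvPolynomial.funext fun v => ?_
    rw [map_zero]
    -- the restriction of `p` to the line spanned by `v`
    let P : Polynomial ℝ := ∑ d ∈ Finset.range (p.totalDegree + 1),
      Polynomial.C (eval v (homogeneousComponent d p)) * Polynomial.X ^ d
    have hP : ∀ t, P.eval t = eval (t • v) p := fun t => by
      simp [P, eval_smul_eq_sum, Polynomial.eval_finsetSum]
    have hcoeff : P.coeff d = eval v (homogeneousComponent d p) := by
      simp only [P, Polynomial.finsetSum_coeff, Polynomial.coeff_C_mul_X_pow]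
      rw [Finset.sum_ite_eq (Finset.range (p.totalDegree + 1)) d, ite_eq_left_iff]
      intro hd'
      rw [homogeneousComponent_eq_zero _ _ (by simpa using hd'), map_zero]
    rw [← hcoeff]
    refine Polynomial.X_pow_dvd_iff.mp (polynomial_X_pow_dvd_of_isBigO ?_) d hd
    have hline : Continuous fun t : ℝ => t • WithLp.toLp 2 v := by fun_prop
    have hT : Filter.Tendsto (fun t : ℝ => t • WithLp.toLp 2 v) (𝓝 0) (𝓝 0) := by
      simpa using hline.tendsto 0
    have h1 := h.comp_tendsto hT
    refine IsBigO.trans ?_ (h1.trans ?_)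
    · refine IsBigO.of_bound 1 (Filter.Eventually.of_forall fun t => ?_)
      rw [hP, one_mul]
      rfl
    · refine IsBigO.of_bound (‖WithLp.toLp 2 v‖ ^ K) (Filter.Eventually.of_forall fun t => ?_)
      simp [norm_smul, mul_pow, mul_comm]
  rw [mem_pow_idealOfVars_iff']
  intro s hs
  have h1 := congrArg (coeff s) (key _ hs)
  rwa [coeff_homogeneousComponent, if_pos rfl, coeff_zero] at h1

end PolynomialOrder

section Nilpotency

variable (A : Type*) [CommRing A] [Algebra ℝ A] [IsWeilAlgebra A]

/-- The maximal ideal of a Weil algebra is nilpotent. -/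
theorem exists_maximalIdeal_pow_eq_bot :
    ∃ K : ℕ, K ≠ 0 ∧ IsLocalRing.maximalIdeal A ^ K = ⊥ := by
  have : IsArtinianRing A := IsArtinianRing.of_finite ℝ A
  obtain ⟨K, hK⟩ := IsArtinianRing.isNilpotent_jacobson_bot (R := A)
  rw [IsLocalRing.jacobson_eq_maximalIdeal ⊥ bot_ne_top] at hK
  refine ⟨K + 1, K.succ_ne_zero, ?_⟩
  rw [pow_succ, hK]
  exact zero_mul _

variable {A}

theorem aeval_eq_zero_of_mem_pow {n K : ℕ} (hK : IsLocalRing.maximalIdeal A ^ K = ⊥)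
    {ν : Fin n → A} (hν : ∀ i, ν i ∈ IsLocalRing.maximalIdeal A) {p : MvPolynomial (Fin n) ℝ}
    (hp : p ∈ MvPolynomial.idealOfVars (Fin n) ℝ ^ K) : MvPolynomial.aeval ν p = 0 := by
  have h1 : (MvPolynomial.idealOfVars (Fin n) ℝ).map (MvPolynomial.aeval ν) ≤
      IsLocalRing.maximalIdeal A := by
    rw [MvPolynomial.idealOfVars, Ideal.map_span, Ideal.span_le]
    rintro _ ⟨_, ⟨i, rfl⟩, rfl⟩
    simpa using hν i
  have h2 := Ideal.mem_map_of_mem (MvPolynomial.aeval ν) hp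
  rw [Ideal.map_pow] at h2
  have h3 := Ideal.pow_right_mono h1 K h2
  rw [hK] at h3
  exact h3

theorem augmentation_eq_zero_iff {a : A} :
    augmentation A a = 0 ↔ a ∈ IsLocalRing.maximalIdeal A := by
  refine ⟨fun h => ?_, fun h => augmentation_eq_of_sub_mem a 0 (by simpa using h)⟩
  have := sub_augmentation_mem a
  rwa [h, map_zero, sub_zero] at this

end Nilpotency

/-! ### Near points in a chart -/

section NearPoints

open MvPolynomial

variable {n : ℕ} {M : Type*} [TopologicalSpace M] [ChartedSpace (EuclideanSpace ℝ (Fin n)) M]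
variable {A : Type*} [CommRing A] [Algebra ℝ A] [IsWeilAlgebra A]

variable (n A) in
/-- The componentwise augmentation `A^n → ℝ^n`. -/
noncomputable def augVec : (Fin n → A) →ₗ[ℝ] EuclideanSpace ℝ (Fin n) :=
  (WithLp.linearEquiv 2 ℝ (Fin n → ℝ)).symm.toLinearMap ∘ₗ
    LinearMap.pi fun i => (augmentation A).toLinearMap ∘ₗ LinearMap.proj i

theorem augVec_apply (a : Fin n → A) (i : Fin n) : augVec n A a i = augmentation A (a i) := rfl

/-- The nilpotent part of a vector in `A^n`. -/
noncomputable def nilPart (a : Fin n → A) (i : Fin n) : A :=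
  a i - algebraMap ℝ A (augVec n A a i)

theorem nilPart_mem (a : Fin n → A) (i : Fin n) :
    nilPart a i ∈ IsLocalRing.maximalIdeal A := sub_augmentation_mem (a i)

variable [IsManifold (𝓡 n) ∞ M]

theorem contMDiffOn_chart_apply {e : OpenPartialHomeomorph M (EuclideanSpace ℝ (Fin n))}
    (he : e ∈ IsManifold.maximalAtlas (𝓡 n) ∞ M) (i : Fin n) :
    ContMDiffOn (𝓡 n) 𝓘(ℝ, ℝ) ∞ (fun y => e y i) e.source := by
  have h1 := contMDiffOn_of_mem_maximalAtlas he
  have h2 : ContMDiff 𝓘(ℝ, EuclideanSpace ℝ (Fin n)) 𝓘(ℝ, ℝ) ∞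
      (fun v : EuclideanSpace ℝ (Fin n) => v i) :=
    (EuclideanSpace.proj i : EuclideanSpace ℝ (Fin n) →L[ℝ] ℝ).contDiff.contMDiff
  exact h2.comp_contMDiffOn h1

/-- Near a point of a chart, a smooth function is a globally smooth function of the coordinates. -/
theorem exists_eventuallyEq_comp_chart {e : OpenPartialHomeomorph M (EuclideanSpace ℝ (Fin n))}
    (he : e ∈ IsManifold.maximalAtlas (𝓡 n) ∞ M) {x : M} (hx : x ∈ e.source)
    (g : C^∞⟮𝓡 n, M; ℝ⟯) :
    ∃ f : EuclideanSpace ℝ (Fin n) → ℝ, ContDiff ℝ ∞ f ∧ ⇑g =ᶠ[𝓝 x] fun y => f (e y) := by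
  have h1 : ContDiffOn ℝ ∞ (g ∘ e.symm) e.target := contMDiffOn_iff_contDiffOn.mp
    (g.contMDiff.comp_contMDiffOn (contMDiffOn_symm_of_mem_maximalAtlas he))
  obtain ⟨f, hf, hfg⟩ := exists_contDiff_eventuallyEq e.open_target h1 (e.map_source hx)
  refine ⟨f, hf, ?_⟩
  filter_upwards [(e.continuousAt hx).eventually hfg, e.open_source.mem_nhds hx] with y hy hys
  rw [hy, Function.comp_apply, e.left_inv hys]

variable [T2Space M]

/-- A smooth function that vanishes near `x` is killed by a smooth function that equals one near
`x`. -/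
theorem exists_mul_eq_zero {x : M} {f : C^∞⟮𝓡 n, M; ℝ⟯} (hf : ⇑f =ᶠ[𝓝 x] 0) :
    ∃ c : C^∞⟮𝓡 n, M; ℝ⟯, ⇑c =ᶠ[𝓝 x] 1 ∧ c * f = 0 := by
  obtain ⟨χ, -, hχ⟩ := (SmoothBumpFunction.nhds_basis_tsupport (I := 𝓡 n) x).mem_iff.mp hf
  refine ⟨⟨χ, χ.contMDiff⟩, χ.eventuallyEq_one, ?_⟩
  ext y
  by_cases hy : y ∈ tsupport χ
  · have : f y = 0 := hχ hy
    change χ y * f y = 0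
    rw [this, mul_zero]
  · change χ y * f y = 0
    rw [image_eq_zero_of_notMem_tsupport hy, zero_mul]

/-- Global smooth functions with the germs of the coordinate functions of a chart. -/
theorem exists_germ_chart {e : OpenPartialHomeomorph M (EuclideanSpace ℝ (Fin n))}
    (he : e ∈ IsManifold.maximalAtlas (𝓡 n) ∞ M) {x : M} (hx : x ∈ e.source) :
    ∃ u : Fin n → C^∞⟮𝓡 n, M; ℝ⟯, ∀ i, ⇑(u i) =ᶠ[𝓝 x] fun y => e y i :=
  Classical.axiom_of_choice fun i => exists_germ_eq e.open_source hx (contMDiffOn_chart_apply he i)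

theorem NearPoint.coord_eq {e : OpenPartialHomeomorph M (EuclideanSpace ℝ (Fin n))}
    (ξ : NearPoint n M A) {u : Fin n → C^∞⟮𝓡 n, M; ℝ⟯}
    (hu : ∀ i, ⇑(u i) =ᶠ[𝓝 ξ.base] fun y => e y i) (i : Fin n) :
    ξ.coord e i = ξ.toAlgHom (u i) := ξ.evalGerm_eq (u i) (hu i)

theorem NearPoint.augmentation_toAlgHom (ξ : NearPoint n M A) (f : C^∞⟮𝓡 n, M; ℝ⟯) :
    augmentation A (ξ.toAlgHom f) = f ξ.base :=
  augmentation_eq_of_sub_mem _ _ (ξ.sub_mem f)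

theorem NearPoint.augVec_coord {e : OpenPartialHomeomorph M (EuclideanSpace ℝ (Fin n))}
    (he : e ∈ IsManifold.maximalAtlas (𝓡 n) ∞ M) (ξ : NearPoint n M A)
    (hξ : ξ.base ∈ e.source) : augVec n A (ξ.coord e) = e ξ.base := by
  obtain ⟨u, hu⟩ := exists_germ_chart he hξ
  ext i
  rw [augVec_apply, ξ.coord_eq hu, ξ.augmentation_toAlgHom]
  exact (hu i).self_of_nhds

/-- The composite `f(u₁, …, uₙ)` of globally smooth functions. -/
noncomputable def smoothComp (f : EuclideanSpace ℝ (Fin n) → ℝ) (hf : ContDiff ℝ ∞ f)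
    (u : Fin n → C^∞⟮𝓡 n, M; ℝ⟯) : C^∞⟮𝓡 n, M; ℝ⟯ :=
  ⟨fun y => f (WithLp.toLp 2 fun i => u i y), by
    have h1 : ContMDiff (𝓡 n) 𝓘(ℝ, Fin n → ℝ) ∞ fun y => fun i => u i y :=
      contMDiff_pi_space.mpr fun i => (u i).contMDiff
    exact hf.contMDiff.comp
      ((PiLp.continuousLinearEquiv 2 ℝ (fun _ : Fin n => ℝ)).symm.contDiff.contMDiff.comp h1)⟩

theorem smoothComp_eventuallyEq {e : OpenPartialHomeomorph M (EuclideanSpace ℝ (Fin n))} {x : M}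
    {u : Fin n → C^∞⟮𝓡 n, M; ℝ⟯} (hu : ∀ i, ⇑(u i) =ᶠ[𝓝 x] fun y => e y i)
    {f : EuclideanSpace ℝ (Fin n) → ℝ} (hf : ContDiff ℝ ∞ f) :
    ⇑(smoothComp f hf u) =ᶠ[𝓝 x] fun y => f (e y) := by
  filter_upwards [Filter.eventually_all.mpr hu] with y hy
  change f (WithLp.toLp 2 fun i => u i y) = f (e y)
  congr 1
  ext i
  exact hy i

/-- The functions `uᵢ - xᵢ`. -/
noncomputable def centered (u : Fin n → C^∞⟮𝓡 n, M; ℝ⟯) (x : EuclideanSpace ℝ (Fin n))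
    (i : Fin n) : C^∞⟮𝓡 n, M; ℝ⟯ :=
  u i - algebraMap ℝ _ (x i)

/-- The Taylor expansion of a composite `f(u₁, …, uₙ)` about a variable point `x`, as an identity
in the algebra `C^∞(M)`. The coefficients depend smoothly on `x`. -/
theorem exists_smoothComp_eq (K : ℕ) {f : EuclideanSpace ℝ (Fin n) → ℝ} (hf : ContDiff ℝ ∞ f) :
    ∃ (ι κ : Type) (_ : Fintype ι) (_ : Fintype κ) (c : ι → EuclideanSpace ℝ (Fin n) → ℝ)
      (p : ι → MvPolynomial (Fin n) ℝ) (q : κ → MvPolynomial (Fin n) ℝ),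
      (∀ i, ContDiff ℝ ∞ (c i)) ∧ (∀ j, q j ∈ idealOfVars (Fin n) ℝ ^ K) ∧
      ∀ (u : Fin n → C^∞⟮𝓡 n, M; ℝ⟯) (x : EuclideanSpace ℝ (Fin n)),
        ∃ r : κ → C^∞⟮𝓡 n, M; ℝ⟯, smoothComp f hf u =
          ∑ i, c i x • aeval (centered u x) (p i) + ∑ j, r j * aeval (centered u x) (q j) := by
  obtain ⟨ι, κ, hι, hκ, c, p, r, q, hc, hr, hq, h⟩ := exists_taylor_expansion K
    (f := fun z : EuclideanSpace ℝ (Fin n) × EuclideanSpace ℝ (Fin n) => f z.2)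
    (hf.comp contDiff_snd)
  refine ⟨ι, κ, hι, hκ, c, p, q, hc, hq, fun u x =>
    ⟨fun j => smoothComp _ ((hr j).comp (contDiff_prodMk_right x)) u, ?_⟩⟩
  ext y
  let φ : C^∞⟮𝓡 n, M; ℝ⟯ →ₐ[ℝ] ℝ := (Pi.evalAlgHom ℝ _ y).comp ContMDiffMap.coeFnAlgHom
  have hev : ∀ s : MvPolynomial (Fin n) ℝ, φ (aeval (centered u x) s) =
      eval (⇑((WithLp.toLp 2 fun i => u i y : EuclideanSpace ℝ (Fin n)) - x)) s := fun s => by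
    rw [← AlgHom.comp_apply, comp_aeval, ← coe_aeval_eq_eval]
    rfl
  have hφ : ∀ s : C^∞⟮𝓡 n, M; ℝ⟯, s y = φ s := fun _ => rfl
  rw [hφ (_ + _)]
  simp only [map_add, map_sum, map_smul, map_mul, hev]
  exact h x _

end NearPoints

/-! ### Near points are determined by their coordinates -/

section NearPointsExpansion

open MvPolynomial

variable {n : ℕ} {M : Type*} [TopologicalSpace M] [ChartedSpace (EuclideanSpace ℝ (Fin n)) M]
variable {A : Type*} [CommRing A] [Algebra ℝ A] [IsWeilAlgebra A]
variable [IsManifold (𝓡 n) ∞ M] [T2Space M]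

theorem NearPoint.toAlgHom_aeval_centered {e : OpenPartialHomeomorph M (EuclideanSpace ℝ (Fin n))}
    (he : e ∈ IsManifold.maximalAtlas (𝓡 n) ∞ M) (ξ : NearPoint n M A) (hξ : ξ.base ∈ e.source)
    {u : Fin n → C^∞⟮𝓡 n, M; ℝ⟯} (hu : ∀ i, ⇑(u i) =ᶠ[𝓝 ξ.base] fun y => e y i)
    (p : MvPolynomial (Fin n) ℝ) :
    ξ.toAlgHom (aeval (centered u (e ξ.base)) p) = aeval (nilPart (ξ.coord e)) p := by
  rw [← AlgHom.comp_apply, comp_aeval]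
  congr 2
  funext i
  rw [nilPart, ξ.augVec_coord he hξ, ξ.coord_eq hu]
  change ξ.toAlgHom (u i - algebraMap ℝ _ (e ξ.base i)) = _
  rw [map_sub, AlgHom.commutes]

/-- The value of a near point on a smooth function is a Taylor polynomial in the nilpotent parts of
its coordinates, with coefficients that depend smoothly on the base point. -/
theorem exists_toAlgHom_eq_sum {e : OpenPartialHomeomorph M (EuclideanSpace ℝ (Fin n))}
    (he : e ∈ IsManifold.maximalAtlas (𝓡 n) ∞ M) {x : M} (hx : x ∈ e.source)
    (A : Type*) [CommRing A] [Algebra ℝ A] [IsWeilAlgebra A] (g : C^∞⟮𝓡 n, M; ℝ⟯) :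
    ∃ (ι : Type) (_ : Fintype ι) (c : ι → EuclideanSpace ℝ (Fin n) → ℝ)
      (p : ι → MvPolynomial (Fin n) ℝ), (∀ i, ContDiff ℝ ∞ (c i)) ∧
      ∀ᶠ y in 𝓝 x, ∀ ξ : NearPoint n M A, ξ.base = y →
        ξ.toAlgHom g =
          ∑ i, c i (augVec n A (ξ.coord e)) • aeval (nilPart (ξ.coord e)) (p i) := by
  obtain ⟨K, -, hK⟩ := exists_maximalIdeal_pow_eq_bot A
  obtain ⟨f, hf, hgf⟩ := exists_eventuallyEq_comp_chart he hx g
  obtain ⟨ι, κ, hι, hκ, c, p, q, hc, hq, h⟩ := exists_smoothComp_eq (M := M) K hf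
  refine ⟨ι, hι, c, p, hc, ?_⟩
  filter_upwards [eventually_eventually_nhds.mpr hgf, e.open_source.mem_nhds hx]
    with y hy hys ξ hξ
  subst hξ
  obtain ⟨u, hu⟩ := exists_germ_chart he hys
  obtain ⟨r, hr⟩ := h u (e ξ.base)
  have h1 : ⇑g =ᶠ[𝓝 ξ.base] ⇑(smoothComp f hf u) :=
    Filter.EventuallyEq.trans hy (smoothComp_eventuallyEq hu hf).symm
  rw [ξ.toAlgHom_congr h1, hr, ξ.augVec_coord he hys]
  simp only [map_add, map_sum, map_smul, map_mul, ξ.toAlgHom_aeval_centered he hys hu]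
  rw [add_eq_left]
  refine Finset.sum_eq_zero fun j _ => ?_
  rw [aeval_eq_zero_of_mem_pow hK (nilPart_mem _) (hq j), mul_zero]

theorem NearPoint.ext_of_coord_eq {e : OpenPartialHomeomorph M (EuclideanSpace ℝ (Fin n))}
    (he : e ∈ IsManifold.maximalAtlas (𝓡 n) ∞ M) {ξ ζ : NearPoint n M A} (hξ : ξ.base ∈ e.source)
    (hζ : ζ.base ∈ e.source) (h : ξ.coord e = ζ.coord e) : ξ = ζ := by
  have hb : ξ.base = ζ.base := by
    apply e.injOn hξ hζ
    rw [← ξ.augVec_coord he hξ, ← ζ.augVec_coord he hζ, h]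
  have hhom : ξ.toAlgHom = ζ.toAlgHom := by
    ext g
    obtain ⟨ι, _, c, p, -, H⟩ := exists_toAlgHom_eq_sum he hξ A g
    rw [H.self_of_nhds ξ rfl, H.self_of_nhds ζ hb.symm, h]
  cases ξ
  cases ζ
  simp only at hb hhom
  subst hb hhom
  rfl

/-- A derivation along a near point `ξ` that kills functions with the germs of the coordinates at
the base point is zero: in a Taylor expansion of high order it kills the polynomials, and on a
product `r * q` with `q` of order `K` it is zero because `ξ` kills `q`. -/
theorem NearPoint.derivation_eq_zero {e : OpenPartialHomeomorph M (EuclideanSpace ℝ (Fin n))}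
    (he : e ∈ IsManifold.maximalAtlas (𝓡 n) ∞ M) (ξ : NearPoint n M A) (hξ : ξ.base ∈ e.source)
    {u : Fin n → C^∞⟮𝓡 n, M; ℝ⟯} (hu : ∀ i, ⇑(u i) =ᶠ[𝓝 ξ.base] fun y => e y i)
    (δ : C^∞⟮𝓡 n, M; ℝ⟯ →ₗ[ℝ] A)
    (hδ : ∀ f g, δ (f * g) = ξ.toAlgHom f * δ g + ξ.toAlgHom g * δ f) (h0 : ∀ i, δ (u i) = 0) :
    δ = 0 := by
  obtain ⟨K, -, hK⟩ := exists_maximalIdeal_pow_eq_bot A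
  have hone : δ 1 = 0 := by
    have := hδ 1 1
    rw [mul_one, map_one ξ.toAlgHom, one_mul, left_eq_add] at this
    exact this
  have hconst : ∀ r : ℝ, δ (algebraMap ℝ _ r) = 0 := fun r => by
    rw [Algebra.algebraMap_eq_smul_one, map_smul, hone, smul_zero]
  have hpoly : ∀ s : MvPolynomial (Fin n) ℝ, δ (aeval (centered u (e ξ.base)) s) = 0 := fun s => by
    induction s using MvPolynomial.induction_on with
    | C r => rw [aeval_C, hconst]
    | add p q hp hq => rw [map_add, map_add, hp, hq, add_zero]
    | mul_X p i hp =>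
      rw [map_mul, hδ, hp, aeval_X, mul_zero, add_zero, centered, map_sub, h0, hconst, sub_zero,
        mul_zero]
  have hlocal : ∀ f : C^∞⟮𝓡 n, M; ℝ⟯, ⇑f =ᶠ[𝓝 ξ.base] 0 → δ f = 0 := fun f hf => by
    obtain ⟨c, hc1, hc⟩ := exists_mul_eq_zero hf
    have h1 : ξ.toAlgHom c = 1 := by
      rw [← map_one ξ.toAlgHom]
      exact ξ.toAlgHom_congr hc1
    have h2 : ξ.toAlgHom f = 0 := by
      rw [← map_zero ξ.toAlgHom]
      exact ξ.toAlgHom_congr hf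
    have h3 := hδ c f
    rw [hc, map_zero, h1, h2, one_mul, zero_mul, add_zero] at h3
    exact h3.symm
  ext g
  obtain ⟨f, hf, hgf⟩ := exists_eventuallyEq_comp_chart he hξ g
  obtain ⟨ι, κ, hι, hκ, c, p, q, hc, hq, h⟩ := exists_smoothComp_eq (M := M) K hf
  obtain ⟨r, hr⟩ := h u (e ξ.base)
  have h1 : δ (g - smoothComp f hf u) = 0 := hlocal _ <| by
    filter_upwards [hgf, smoothComp_eventuallyEq hu hf] with y hy hy'
    change g y - smoothComp f hf u y = 0
    rw [hy, hy', sub_self]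
  rw [map_sub, sub_eq_zero] at h1
  rw [h1, hr, map_add, map_sum, map_sum, LinearMap.zero_apply]
  simp only [map_smul, hδ, hpoly, ξ.toAlgHom_aeval_centered he hξ hu,
    aeval_eq_zero_of_mem_pow hK (nilPart_mem _) (hq _), zero_mul, mul_zero, smul_zero,
    Finset.sum_const_zero, add_zero]

end NearPointsExpansion

/-! ### Every admissible vector is a coordinate vector -/

section Surjectivity

open MvPolynomial Asymptotics

variable {n : ℕ} {M : Type*} [TopologicalSpace M] [ChartedSpace (EuclideanSpace ℝ (Fin n)) M]
variable {A : Type*} [CommRing A] [Algebra ℝ A] [IsWeilAlgebra A]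

/-- `p` is a Taylor polynomial of `g`, up to terms of degree at least `K`, at the point with
coordinates `x`. -/
def IsTaylor (e : OpenPartialHomeomorph M (EuclideanSpace ℝ (Fin n)))
    (x : EuclideanSpace ℝ (Fin n)) (K : ℕ) (g : M → ℝ) (p : MvPolynomial (Fin n) ℝ) : Prop :=
  (fun y : EuclideanSpace ℝ (Fin n) => g (e.symm (x + y)) - eval (⇑y) p) =O[𝓝 0]
    fun y => ‖y‖ ^ K

namespace IsTaylor

variable {e : OpenPartialHomeomorph M (EuclideanSpace ℝ (Fin n))} {x : EuclideanSpace ℝ (Fin n)}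
  {K : ℕ} {g h : M → ℝ} {p q : MvPolynomial (Fin n) ℝ}

theorem const (r : ℝ) : IsTaylor e x K (fun _ => r) (C r) := by
  simp only [IsTaylor, eval_C, sub_self]
  exact isBigO_zero _ _

theorem add (hg : IsTaylor e x K g p) (hh : IsTaylor e x K h q) :
    IsTaylor e x K (fun y => g y + h y) (p + q) := by
  refine (IsBigO.add hg hh).congr_left fun y => ?_
  rw [map_add]
  ring

theorem isBigO_one (hg : IsTaylor e x K g p) :
    (fun y : EuclideanSpace ℝ (Fin n) => g (e.symm (x + y))) =O[𝓝 0] fun _ => (1 : ℝ) := by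
  have h1 : (fun y : EuclideanSpace ℝ (Fin n) => ‖y‖ ^ K) =O[𝓝 0] fun _ => (1 : ℝ) :=
    (by fun_prop : Continuous fun y : EuclideanSpace ℝ (Fin n) =>
      ‖y‖ ^ K).continuousAt.isBigO_one ℝ
  have h2 : (fun y : EuclideanSpace ℝ (Fin n) => eval (⇑y) p) =O[𝓝 0] fun _ => (1 : ℝ) := by
    have := MvPolynomial.continuous_eval p
    exact (by fun_prop : Continuous fun y : EuclideanSpace ℝ (Fin n) =>
      eval (⇑y) p).continuousAt.isBigO_one ℝ
  exact ((IsBigO.trans hg h1).add h2).congr_left fun y => sub_add_cancel _ _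

theorem mul (hg : IsTaylor e x K g p) (hh : IsTaylor e x K h q) :
    IsTaylor e x K (fun y => g y * h y) (p * q) := by
  have h2 : (fun y : EuclideanSpace ℝ (Fin n) => eval (⇑y) p) =O[𝓝 0] fun _ => (1 : ℝ) := by
    have := MvPolynomial.continuous_eval p
    exact (by fun_prop : Continuous fun y : EuclideanSpace ℝ (Fin n) =>
      eval (⇑y) p).continuousAt.isBigO_one ℝ
  have h3 := IsBigO.mul hg hh.isBigO_one
  have h4 := h2.mul hh
  simp only [mul_one, one_mul] at h3 h4
  refine (h3.add h4).congr_left fun y => ?_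
  rw [map_mul]
  ring

theorem eval_zero_eq (hK : K ≠ 0) (hg : IsTaylor e x K g p) : eval 0 p = g (e.symm x) := by
  obtain ⟨C, hC⟩ := hg.bound
  have h1 := hC.self_of_nhds
  rw [norm_zero, zero_pow hK, norm_zero, mul_zero, norm_le_zero_iff, add_zero, sub_eq_zero] at h1
  exact h1.symm

/-- Two Taylor polynomials of the same function have the same value on nilpotent vectors. -/
theorem aeval_eq {ν : Fin n → A} (hK : IsLocalRing.maximalIdeal A ^ K = ⊥)
    (hν : ∀ i, ν i ∈ IsLocalRing.maximalIdeal A) (hp : IsTaylor e x K g p)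
    (hq : IsTaylor e x K g q) : aeval ν p = aeval ν q := by
  rw [← sub_eq_zero, ← map_sub]
  refine aeval_eq_zero_of_mem_pow hK hν (mem_idealOfVars_pow_of_isBigO ?_)
  refine (IsBigO.sub hq hp).congr_left fun y => ?_
  rw [map_sub]
  ring

variable [IsManifold (𝓡 n) ∞ M]

theorem exists_isTaylor (he : e ∈ IsManifold.maximalAtlas (𝓡 n) ∞ M) (hx : x ∈ e.target) (K : ℕ)
    (g : C^∞⟮𝓡 n, M; ℝ⟯) : ∃ p, IsTaylor e x K g p := by
  obtain ⟨f, hf, hgf⟩ := exists_eventuallyEq_comp_chart he (e.map_target hx) g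
  obtain ⟨ι, κ, hι, hκ, c, p, r, q, hc, hr, hq, h⟩ := exists_taylor_expansion K
    (f := fun z : EuclideanSpace ℝ (Fin n) × EuclideanSpace ℝ (Fin n) => f z.2)
    (hf.comp contDiff_snd)
  refine ⟨∑ i, C (c i x) * p i, ?_⟩
  have hcont : Filter.Tendsto (fun y => x + y) (𝓝 0) (𝓝 x) := by
    simpa using (continuous_const_add x).tendsto 0
  have h1 : (fun y => ∑ j, r j (x, x + y) * eval (⇑y) (q j)) =O[𝓝 0]
      fun y : EuclideanSpace ℝ (Fin n) => ‖y‖ ^ K := by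
    refine IsBigO.fun_sum fun j _ => ?_
    have h2 : (fun y : EuclideanSpace ℝ (Fin n) => r j (x, x + y)) =O[𝓝 0] fun _ => (1 : ℝ) := by
      have := (hr j).continuous
      exact (by fun_prop : Continuous fun y => r j (x, x + y)).continuousAt.isBigO_one ℝ
    simpa only [one_mul] using h2.mul (isBigO_eval_of_mem_pow (hq j))
  refine h1.congr' ?_ Filter.EventuallyEq.rfl
  have hsymm : Filter.Tendsto (fun y => e.symm (x + y)) (𝓝 0) (𝓝 (e.symm x)) :=
    (e.continuousAt_symm hx).tendsto.comp hcont
  filter_upwards [hsymm.eventually hgf, hcont.eventually (e.open_target.mem_nhds hx)] with y hy hyt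
  rw [hy, e.right_inv hyt, h x (x + y), add_sub_cancel_left]
  simp [map_sum]

end IsTaylor

variable [IsManifold (𝓡 n) ∞ M] [T2Space M]

/-- Every vector of `coordTarget` is the coordinate vector of a near point: a function is sent to
the value of one of its Taylor polynomials on the nilpotent part of the vector. -/
theorem exists_coord_eq {e : OpenPartialHomeomorph M (EuclideanSpace ℝ (Fin n))}
    (he : e ∈ IsManifold.maximalAtlas (𝓡 n) ∞ M) {a : Fin n → A} (ha : a ∈ coordTarget A e) :
    ∃ ξ : NearPoint n M A, ξ.base ∈ e.source ∧ ξ.coord e = a := by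
  obtain ⟨K, hK0, hK⟩ := exists_maximalIdeal_pow_eq_bot A
  have hx : augVec n A a ∈ e.target := ha
  set x := augVec n A a with hxdef
  choose T hT using fun g => IsTaylor.exists_isTaylor he hx K g
  have hval : ∀ {g : C^∞⟮𝓡 n, M; ℝ⟯} {p}, IsTaylor e x K g p →
      aeval (nilPart a) (T g) = aeval (nilPart a) p := fun hp =>
    (hT _).aeval_eq hK (nilPart_mem a) hp
  let φ : C^∞⟮𝓡 n, M; ℝ⟯ →ₐ[ℝ] A :=
    { toFun := fun g => aeval (nilPart a) (T g)
      map_one' := (hval (g := 1) (IsTaylor.const 1)).trans (by simp)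
      map_mul' := fun f g => (hval (g := f * g) ((hT f).mul (hT g))).trans (by simp)
      map_zero' := (hval (g := 0) (IsTaylor.const 0)).trans (by simp)
      map_add' := fun f g => (hval (g := f + g) ((hT f).add (hT g))).trans (by simp)
      commutes' := fun r => (hval (g := algebraMap ℝ _ r) (IsTaylor.const r)).trans (by simp) }
  have hφ : ∀ g, φ g - algebraMap ℝ A (g (e.symm x)) ∈ IsLocalRing.maximalIdeal A := fun g => by
    rw [← (hT g).eval_zero_eq hK0, ← augmentation_eq_zero_iff, map_sub, AlgHom.commutes,
      sub_eq_zero]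
    change augmentation A (aeval (nilPart a) (T g)) = _
    rw [← AlgHom.comp_apply, comp_aeval, ← coe_aeval_eq_eval]
    change aeval _ _ = aeval _ _
    congr 2
    funext i
    exact augmentation_eq_zero_iff.mpr (nilPart_mem a i)
  have hs : e.symm x ∈ e.source := e.map_target hx
  refine ⟨⟨e.symm x, φ, hφ⟩, hs, ?_⟩
  funext i
  obtain ⟨u, hu⟩ := exists_germ_chart he hs
  rw [NearPoint.coord_eq _ hu]
  have hcont : Filter.Tendsto (fun y => x + y) (𝓝 0) (𝓝 x) := by
    simpa using (continuous_const_add x).tendsto 0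
  have hui : IsTaylor e x K (u i) (X i + C (x i)) := by
    refine (isBigO_zero _ _).congr' ?_ Filter.EventuallyEq.rfl
    have hsymm : Filter.Tendsto (fun y => e.symm (x + y)) (𝓝 0) (𝓝 (e.symm x)) :=
      (e.continuousAt_symm hx).tendsto.comp hcont
    filter_upwards [hsymm.eventually (hu i), hcont.eventually (e.open_target.mem_nhds hx)]
      with y hy hyt
    rw [hy, e.right_inv hyt]
    simp [add_comm]
  change aeval (nilPart a) (T (u i)) = a i
  rw [hval hui]
  simp [nilPart, hxdef]

end Surjectivity

/-! ### Smooth functions on `M^A` in charts -/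

section MoreCalculus

variable {V W : Type*} [AddCommGroup V] [Module ℝ V] [Module.Finite ℝ V]
  [AddCommGroup W] [Module ℝ W] [Module.Finite ℝ W]

theorem IsSmoothAt.of_contDiff {F F' : Type*} [NormedAddCommGroup F] [NormedSpace ℝ F]
    [FiniteDimensional ℝ F] [NormedAddCommGroup F'] [NormedSpace ℝ F'] [FiniteDimensional ℝ F']
    {f : F → F'} (hf : ContDiff ℝ ∞ f) (a : F) : IsSmoothAt f a := by
  have h1 : ContDiff ℝ ∞ (linCoord F') :=
    (LinearMap.toContinuousLinearMap (linCoord F').toLinearMap).contDiff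
  have h2 : ContDiff ℝ ∞ (linCoord F).symm :=
    (LinearMap.toContinuousLinearMap (linCoord F).symm.toLinearMap).contDiff
  exact (h1.comp (hf.comp h2)).contDiffAt

variable {A : Type*} [CommRing A] [Algebra ℝ A] [Module.Finite ℝ A]

theorem IsSmoothAt.smul {c : V → ℝ} {G : V → A} {a : V} (hc : IsSmoothAt c a)
    (hG : IsSmoothAt G a) : IsSmoothAt (fun v => c v • G v) a := by
  simp only [Algebra.smul_def]
  exact ((IsSmoothAt.linearMap (Algebra.linearMap ℝ A) _).comp hc).mul hG

theorem IsSmoothAt.aeval {n : ℕ} {ν : V → Fin n → A} {a : V}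
    (hν : ∀ i, IsSmoothAt (fun v => ν v i) a) (p : MvPolynomial (Fin n) ℝ) :
    IsSmoothAt (fun v => MvPolynomial.aeval (ν v) p) a := by
  induction p using MvPolynomial.induction_on with
  | C r => simpa only [MvPolynomial.aeval_C] using IsSmoothAt.const _ _
  | add p q hp hq => simpa only [map_add] using hp.add hq
  | mul_X p i hp => simpa only [map_mul, MvPolynomial.aeval_X] using hp.mul (hν i)

end MoreCalculus

section SmoothFunctions

variable {n : ℕ} {M : Type*} [TopologicalSpace M] [ChartedSpace (EuclideanSpace ℝ (Fin n)) M]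
variable {A : Type*} [CommRing A] [Algebra ℝ A] [IsWeilAlgebra A]
variable {W W' : Type*} [AddCommGroup W] [Module ℝ W] [Module.Finite ℝ W]
  [AddCommGroup W'] [Module ℝ W'] [Module.Finite ℝ W']

/-- The function `φ` on `M^A` read in the coordinates of the chart `e`. -/
noncomputable def inChart (e : OpenPartialHomeomorph M (EuclideanSpace ℝ (Fin n)))
    (φ : NearPoint n M A → W) (a : Fin n → A) : W :=
  open Classical in
  if h : ∃ ξ : NearPoint n M A, ξ.base ∈ e.source ∧ ξ.coord e = a then φ h.choose else 0

variable [IsManifold (𝓡 n) ∞ M] [T2Space M]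
variable {e : OpenPartialHomeomorph M (EuclideanSpace ℝ (Fin n))}

theorem inChart_coord (he : e ∈ IsManifold.maximalAtlas (𝓡 n) ∞ M) (φ : NearPoint n M A → W)
    {ξ : NearPoint n M A} (hξ : ξ.base ∈ e.source) : inChart e φ (ξ.coord e) = φ ξ := by
  have h : ∃ ζ : NearPoint n M A, ζ.base ∈ e.source ∧ ζ.coord e = ξ.coord e := ⟨ξ, hξ, rfl⟩
  rw [inChart, dif_pos h]
  exact congrArg φ (NearPoint.ext_of_coord_eq he h.choose_spec.1 hξ h.choose_spec.2)

/-- A property of the base points near `ξ.base` holds for all near points with coordinates close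
to those of `ξ`, and these coordinates fill a neighbourhood. -/
theorem eventually_exists_coord_eq (he : e ∈ IsManifold.maximalAtlas (𝓡 n) ∞ M)
    {ξ : NearPoint n M A} (hξ : ξ.base ∈ e.source) {p : M → Prop} (hp : ∀ᶠ y in 𝓝 ξ.base, p y) :
    ∀ᶠ a in linNhds (ξ.coord e), ∃ ζ : NearPoint n M A,
      ζ.base ∈ e.source ∧ p ζ.base ∧ ζ.coord e = a := by
  have h1 := tendsto_linNhds_of_linearMap (augVec n A) (ξ.coord e)
  rw [ξ.augVec_coord he hξ] at h1
  have h2 : Filter.Tendsto e.symm (𝓝 (e ξ.base)) (𝓝 ξ.base) := by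
    have := e.continuousAt_symm (e.map_source hξ)
    rwa [ContinuousAt, e.left_inv hξ] at this
  filter_upwards [(h2.comp h1).eventually hp,
    h1.eventually (e.open_target.mem_nhds (e.map_source hξ))] with a ha hat
  obtain ⟨ζ, hζ, rfl⟩ := exists_coord_eq he (a := a) hat
  refine ⟨ζ, hζ, ?_, rfl⟩
  rwa [Function.comp_apply, ζ.augVec_coord he hζ, e.left_inv hζ] at ha

theorem inChart_eventuallyEq (he : e ∈ IsManifold.maximalAtlas (𝓡 n) ∞ M)
    {ξ : NearPoint n M A} (hξ : ξ.base ∈ e.source) {φ : NearPoint n M A → W}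
    {G : (Fin n → A) → W}
    (h : ∀ᶠ y in 𝓝 ξ.base, ∀ ζ : NearPoint n M A, ζ.base = y → φ ζ = G (ζ.coord e)) :
    inChart e φ =ᶠ[linNhds (ξ.coord e)] G := by
  filter_upwards [eventually_exists_coord_eq he hξ h] with a ⟨ζ, hζ, hζG, hζa⟩
  rw [← hζa, inChart_coord he φ hζ, hζG ζ rfl]

theorem IsSmooth.isSmoothAt {φ : NearPoint n M A → W} (hφ : IsSmooth φ)
    (he : e ∈ IsManifold.maximalAtlas (𝓡 n) ∞ M) {ξ : NearPoint n M A} (hξ : ξ.base ∈ e.source) :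
    IsSmoothAt (inChart e φ) (ξ.coord e) := by
  obtain ⟨G, hG, hφG⟩ := hφ e he
  have h1 : IsSmoothAt G (ξ.coord e) := by
    refine IsSmoothAt.of_isSmoothOn hG ?_
    filter_upwards [eventually_exists_coord_eq he hξ (p := fun _ => True) (by simp)]
      with a ⟨ζ, hζ, _, hζa⟩
    exact hζa ▸ ζ.coord_mem he hζ
  refine h1.congr (inChart_eventuallyEq he hξ ?_)
  filter_upwards [e.open_source.mem_nhds hξ] with y hy ζ hζ
  exact hφG ζ (hζ ▸ hy)

theorem IsSmooth.eventually_isSmoothAt {φ : NearPoint n M A → W} (hφ : IsSmooth φ)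
    (he : e ∈ IsManifold.maximalAtlas (𝓡 n) ∞ M) {ξ : NearPoint n M A} (hξ : ξ.base ∈ e.source) :
    ∀ᶠ a in linNhds (ξ.coord e), IsSmoothAt (inChart e φ) a := by
  filter_upwards [eventually_exists_coord_eq he hξ (p := fun _ => True) (by simp)]
    with a ⟨ζ, hζ, _, hζa⟩
  exact hζa ▸ hφ.isSmoothAt he hζ

theorem isSmooth_of_local {φ : NearPoint n M A → W}
    (h : ∀ e ∈ IsManifold.maximalAtlas (𝓡 n) ∞ M, ∀ ξ : NearPoint n M A, ξ.base ∈ e.source →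
      ∃ G : (Fin n → A) → W, IsSmoothAt G (ξ.coord e) ∧
        ∀ᶠ y in 𝓝 ξ.base, ∀ ζ : NearPoint n M A, ζ.base = y → φ ζ = G (ζ.coord e)) :
    IsSmooth φ := by
  refine fun e he => ⟨inChart e φ, IsSmoothAt.isSmoothOn fun a ha => ?_, fun ξ hξ =>
    (inChart_coord he φ hξ).symm⟩
  obtain ⟨ξ, hξ, rfl⟩ := exists_coord_eq he ha
  obtain ⟨G, hG, hφG⟩ := h e he ξ hξ
  exact hG.congr (inChart_eventuallyEq he hξ hφG)

theorem eventually_eq_inChart (he : e ∈ IsManifold.maximalAtlas (𝓡 n) ∞ M)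
    (φ : NearPoint n M A → W) {x : M} (hx : x ∈ e.source) :
    ∀ᶠ y in 𝓝 x, ∀ ζ : NearPoint n M A, ζ.base = y → φ ζ = inChart e φ (ζ.coord e) := by
  filter_upwards [e.open_source.mem_nhds hx] with y hy ζ hζ
  exact (inChart_coord he φ (hζ ▸ hy)).symm

theorem IsSmooth.comp {φ : NearPoint n M A → W} (hφ : IsSmooth φ) {H : W → W'}
    (hH : ∀ w, IsSmoothAt H w) : IsSmooth fun ξ => H (φ ξ) := by
  refine isSmooth_of_local fun e he ξ hξ => ⟨fun a => H (inChart e φ a),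
    (hH _).comp (hφ.isSmoothAt he hξ), ?_⟩
  filter_upwards [eventually_eq_inChart he φ hξ] with y hy ζ hζ
  rw [← hy ζ hζ]

theorem IsSmooth.pi {ι : Type*} [Fintype ι] {φ : NearPoint n M A → ι → W}
    (hφ : ∀ i, IsSmooth fun ξ => φ ξ i) : IsSmooth φ := by
  refine isSmooth_of_local fun e he ξ hξ => ⟨fun a i => inChart e (fun ζ => φ ζ i) a,
    IsSmoothAt.pi fun i => (hφ i).isSmoothAt he hξ, ?_⟩
  filter_upwards [Filter.eventually_all.mpr fun i =>
    eventually_eq_inChart he (fun ζ => φ ζ i) hξ] with y hy ζ hζ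
  funext i
  exact hy i ζ hζ

theorem isSmooth_prolong (g : C^∞⟮𝓡 n, M; ℝ⟯) : IsSmooth (prolong (A := A) g) := by
  refine isSmooth_of_local fun e he ξ hξ => ?_
  obtain ⟨ι, _, c, p, hc, h⟩ := exists_toAlgHom_eq_sum he hξ A g
  refine ⟨fun a => ∑ i, c i (augVec n A a) • MvPolynomial.aeval (nilPart a) (p i),
    IsSmoothAt.sum fun i _ => ?_, h⟩
  have h1 : IsSmoothAt (fun a => c i (augVec n A a)) (ξ.coord e) :=
    (IsSmoothAt.of_contDiff (hc i) _).comp (IsSmoothAt.linearMap (augVec n A) _)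
  refine h1.smul (IsSmoothAt.aeval (fun j => ?_) _)
  let L : (Fin n → A) →ₗ[ℝ] A := LinearMap.proj j -
    Algebra.linearMap ℝ A ∘ₗ (augmentation A).toLinearMap ∘ₗ
      LinearMap.proj (φ := fun _ : Fin n => A) j
  exact IsSmoothAt.linearMap L _

end SmoothFunctions

/-! ### Prolongation of vector fields -/

section Prolongation

variable {n : ℕ} {M : Type*} [TopologicalSpace M] [ChartedSpace (EuclideanSpace ℝ (Fin n)) M]
variable {A : Type*} [CommRing A] [Algebra ℝ A] [IsWeilAlgebra A]
variable {W W' : Type*} [AddCommGroup W] [Module ℝ W] [Module.Finite ℝ W]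
  [AddCommGroup W'] [Module ℝ W'] [Module.Finite ℝ W']
variable [IsManifold (𝓡 n) ∞ M] [T2Space M]
variable {e e' : OpenPartialHomeomorph M (EuclideanSpace ℝ (Fin n))}

/-- Vector fields are local operators. -/
theorem derivation_eventuallyEq
    (θ : Derivation ℝ C^∞⟮𝓡 n, M; ℝ⟯ C^∞⟮𝓡 n, M; ℝ⟯)
    {x : M} {f g : C^∞⟮𝓡 n, M; ℝ⟯} (hfg : ⇑f =ᶠ[𝓝 x] ⇑g) : ⇑(θ f) =ᶠ[𝓝 x] ⇑(θ g) := by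
  have hz : ⇑(f - g) =ᶠ[𝓝 x] 0 := by
    filter_upwards [hfg] with y hy
    change f y - g y = 0
    rw [hy, sub_self]
  obtain ⟨c, hc1, hc⟩ := exists_mul_eq_zero hz
  have h1 := θ.leibniz c (f - g)
  rw [hc, map_zero, map_sub] at h1
  filter_upwards [hfg, hc1] with y hy hcy
  have h2 : 0 = c y * (θ f y - θ g y) + (f y - g y) * θ c y :=
    congrArg (fun s : C^∞⟮𝓡 n, M; ℝ⟯ => s y) h1
  rw [hy, hcy, sub_self, zero_mul, add_zero, Pi.one_apply, one_mul] at h2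
  exact sub_eq_zero.mp h2.symm

theorem inChart_add (φ ψ : NearPoint n M A → W) :
    inChart e (φ + ψ) = fun a => inChart e φ a + inChart e ψ a := by
  funext a
  unfold inChart
  split_ifs <;> simp

theorem inChart_mul (φ ψ : NearPoint n M A → A) :
    inChart e (φ * ψ) = fun a => inChart e φ a * inChart e ψ a := by
  funext a
  unfold inChart
  split_ifs <;> simp

theorem inChart_linearMap_comp (L : W →ₗ[ℝ] W') (φ : NearPoint n M A → W) :
    inChart e (fun ξ => L (φ ξ)) = fun a => L (inChart e φ a) := by
  funext a
  unfold inChart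
  split_ifs <;> simp

theorem dirDeriv_inChart_linearMap_comp (he : e ∈ IsManifold.maximalAtlas (𝓡 n) ∞ M)
    {ξ : NearPoint n M A} (hξ : ξ.base ∈ e.source) (L : W →ₗ[ℝ] W') {φ : NearPoint n M A → W}
    (hφ : IsSmooth φ) (v : Fin n → A) :
    dirDeriv (inChart e fun ξ => L (φ ξ)) (ξ.coord e) v =
      L (dirDeriv (inChart e φ) (ξ.coord e) v) := by
  rw [inChart_linearMap_comp,
    dirDeriv_comp (IsSmoothAt.linearMap L _) (hφ.isSmoothAt he hξ), dirDeriv_linearMap]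

/-- The values of the near point `ξ` on the derivatives `θ(xᵢ)` of the coordinate functions of `e`,
where `xᵢ` is replaced by a global function with the same germ at the base point. These are the
components at `ξ` of the prolongation of the vector field `θ`; they are zero by convention if there
are no such global functions. -/
noncomputable def velocity (θ : Derivation ℝ C^∞⟮𝓡 n, M; ℝ⟯ C^∞⟮𝓡 n, M; ℝ⟯)
    (e : OpenPartialHomeomorph M (EuclideanSpace ℝ (Fin n))) (ξ : NearPoint n M A) :
    Fin n → A := fun i =>
  open Classical in
  if h : ∃ u : Fin n → C^∞⟮𝓡 n, M; ℝ⟯, ∀ i, ⇑(u i) =ᶠ[𝓝 ξ.base] fun y => e y i then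
    ξ.toAlgHom (θ (h.choose i)) else 0

theorem velocity_eq (θ : Derivation ℝ C^∞⟮𝓡 n, M; ℝ⟯ C^∞⟮𝓡 n, M; ℝ⟯)
    {ξ : NearPoint n M A} {u : Fin n → C^∞⟮𝓡 n, M; ℝ⟯}
    (hu : ∀ i, ⇑(u i) =ᶠ[𝓝 ξ.base] fun y => e y i) (i : Fin n) :
    velocity θ e ξ i = ξ.toAlgHom (θ (u i)) := by
  have h : ∃ u : Fin n → C^∞⟮𝓡 n, M; ℝ⟯, ∀ i, ⇑(u i) =ᶠ[𝓝 ξ.base] fun y => e y i := ⟨u, hu⟩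
  rw [velocity, dif_pos h]
  exact ξ.toAlgHom_congr (derivation_eventuallyEq θ ((h.choose_spec i).trans (hu i).symm))

theorem inChart_prolong_chart (he : e ∈ IsManifold.maximalAtlas (𝓡 n) ∞ M)
    {ξ : NearPoint n M A} (hξ : ξ.base ∈ e.source) {u : Fin n → C^∞⟮𝓡 n, M; ℝ⟯}
    (hu : ∀ i, ⇑(u i) =ᶠ[𝓝 ξ.base] fun y => e y i) (i : Fin n) :
    inChart e (prolong (A := A) (u i)) =ᶠ[linNhds (ξ.coord e)] fun a => a i := by
  refine inChart_eventuallyEq he hξ ?_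
  filter_upwards [Filter.eventually_all.mpr fun i => eventually_eventually_nhds.mpr (hu i)]
    with y hy ζ hζ
  subst hζ
  exact (ζ.coord_eq hy i).symm

/-- In a chart, the derivative of `g^A` in the direction of the velocity is `(θ g)^A`. Both sides
are derivations along `ξ` and they agree on the coordinate functions. -/
theorem dirDeriv_inChart_prolong (θ : Derivation ℝ C^∞⟮𝓡 n, M; ℝ⟯ C^∞⟮𝓡 n, M; ℝ⟯)
    (he : e ∈ IsManifold.maximalAtlas (𝓡 n) ∞ M)
    {ξ : NearPoint n M A} (hξ : ξ.base ∈ e.source) (g : C^∞⟮𝓡 n, M; ℝ⟯) :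
    dirDeriv (inChart e (prolong (A := A) g)) (ξ.coord e) (velocity θ e ξ) =
      ξ.toAlgHom (θ g) := by
  obtain ⟨u, hu⟩ := exists_germ_chart he hξ
  have hs : ∀ f : C^∞⟮𝓡 n, M; ℝ⟯, IsSmoothAt (inChart e (prolong (A := A) f)) (ξ.coord e) :=
    fun f => (isSmooth_prolong f).isSmoothAt he hξ
  let δ : C^∞⟮𝓡 n, M; ℝ⟯ →ₗ[ℝ] A :=
    { toFun := fun f => dirDeriv (inChart e (prolong (A := A) f)) (ξ.coord e) (velocity θ e ξ)
      map_add' := fun f h => by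
        have : prolong (A := A) (f + h) = prolong f + prolong h := by
          funext ζ
          exact map_add ζ.toAlgHom f h
        rw [this, inChart_add, dirDeriv_add (hs f) (hs h)]
      map_smul' := fun r f => by
        have : prolong (A := A) (r • f) = fun ζ => LinearMap.lsmul ℝ A r (prolong f ζ) := by
          funext ζ
          exact map_smul ζ.toAlgHom r f
        rw [this, dirDeriv_inChart_linearMap_comp he hξ _ (isSmooth_prolong f)]
        rfl }
  have hδ : δ - ξ.toAlgHom.toLinearMap ∘ₗ θ.toLinearMap = 0 := by
    refine ξ.derivation_eq_zero he hξ hu _ (fun f h => ?_) fun i => ?_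
    · have h1 : prolong (A := A) (f * h) = prolong f * prolong h := by
        funext ζ
        exact map_mul ζ.toAlgHom f h
      have h2 : δ (f * h) = ξ.toAlgHom f * δ h + ξ.toAlgHom h * δ f := by
        change dirDeriv (inChart e (prolong (A := A) (f * h))) _ _ = _
        rw [h1, inChart_mul, dirDeriv_mul (hs f) (hs h), inChart_coord he _ hξ,
          inChart_coord he _ hξ]
        rfl
      have h3 : ξ.toAlgHom (θ (f * h)) =
          ξ.toAlgHom f * ξ.toAlgHom (θ h) + ξ.toAlgHom h * ξ.toAlgHom (θ f) := by
        rw [θ.leibniz, map_add, smul_eq_mul, smul_eq_mul, map_mul, map_mul]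
      change δ (f * h) - ξ.toAlgHom (θ (f * h)) = ξ.toAlgHom f * (δ h - ξ.toAlgHom (θ h)) +
        ξ.toAlgHom h * (δ f - ξ.toAlgHom (θ f))
      rw [h2, h3]
      ring
    · change dirDeriv (inChart e (prolong (A := A) (u i))) _ _ - ξ.toAlgHom (θ (u i)) = 0
      rw [dirDeriv_congr (inChart_prolong_chart he hξ hu i), ← velocity_eq θ hu, sub_eq_zero]
      exact dirDeriv_linearMap (LinearMap.proj (φ := fun _ : Fin n => A) i) _ _
  exact sub_eq_zero.mp (LinearMap.congr_fun hδ g)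

/-- The derivative in the direction of the velocity does not depend on the chart. -/
theorem dirDeriv_inChart_eq (θ : Derivation ℝ C^∞⟮𝓡 n, M; ℝ⟯ C^∞⟮𝓡 n, M; ℝ⟯)
    (he : e ∈ IsManifold.maximalAtlas (𝓡 n) ∞ M) (he' : e' ∈ IsManifold.maximalAtlas (𝓡 n) ∞ M)
    {ξ : NearPoint n M A} (hξ : ξ.base ∈ e.source) (hξ' : ξ.base ∈ e'.source)
    {φ : NearPoint n M A → W} (hφ : IsSmooth φ) :
    dirDeriv (inChart e' φ) (ξ.coord e') (velocity θ e' ξ) =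
      dirDeriv (inChart e φ) (ξ.coord e) (velocity θ e ξ) := by
  obtain ⟨u, hu⟩ := exists_germ_chart he hξ
  -- the transition map from the coordinates of `e'` to those of `e`
  let τ : NearPoint n M A → Fin n → A := fun ζ i => prolong (u i) ζ
  have hτ : IsSmooth τ := IsSmooth.pi fun i => isSmooth_prolong (u i)
  have hτξ : inChart e' τ (ξ.coord e') = ξ.coord e := by
    rw [inChart_coord he' _ hξ']
    funext i
    exact (ξ.coord_eq hu i).symm
  have h1 : inChart e' φ =ᶠ[linNhds (ξ.coord e')] fun a => inChart e φ (inChart e' τ a) := by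
    refine inChart_eventuallyEq he' hξ' ?_
    filter_upwards [Filter.eventually_all.mpr fun i => eventually_eventually_nhds.mpr (hu i),
      e.open_source.mem_nhds hξ, e'.open_source.mem_nhds hξ'] with y hy hye hye' ζ hζ
    subst hζ
    have h2 : τ ζ = ζ.coord e := funext fun i => (ζ.coord_eq hy i).symm
    rw [inChart_coord he' _ hye', h2, inChart_coord he _ hye]
  rw [dirDeriv_congr h1, dirDeriv_comp (by rw [hτξ]; exact hφ.isSmoothAt he hξ)
    (hτ.isSmoothAt he' hξ'), hτξ]
  congr 1
  funext i
  rw [velocity_eq θ hu, ← dirDeriv_inChart_prolong θ he' hξ']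
  exact (dirDeriv_inChart_linearMap_comp he' hξ'
    (LinearMap.proj (φ := fun _ : Fin n => A) i) hτ _).symm

/-- The derivative of a function on `M^A` along the prolongation of the vector field `θ`, computed
in the preferred chart at the base point. -/
noncomputable def prolongDeriv (θ : Derivation ℝ C^∞⟮𝓡 n, M; ℝ⟯ C^∞⟮𝓡 n, M; ℝ⟯)
    (φ : NearPoint n M A → W) (ξ : NearPoint n M A) : W :=
  dirDeriv (inChart (chartAt _ ξ.base) φ) (ξ.coord (chartAt _ ξ.base))
    (velocity θ (chartAt _ ξ.base) ξ)

variable (θ : Derivation ℝ C^∞⟮𝓡 n, M; ℝ⟯ C^∞⟮𝓡 n, M; ℝ⟯)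

theorem prolongDeriv_eq (he : e ∈ IsManifold.maximalAtlas (𝓡 n) ∞ M) {ξ : NearPoint n M A}
    (hξ : ξ.base ∈ e.source) {φ : NearPoint n M A → W} (hφ : IsSmooth φ) :
    prolongDeriv θ φ ξ = dirDeriv (inChart e φ) (ξ.coord e) (velocity θ e ξ) :=
  dirDeriv_inChart_eq θ he (IsManifold.chart_mem_maximalAtlas _) hξ (mem_chart_source _ _) hφ

theorem isSmooth_prolongDeriv {φ : NearPoint n M A → W} (hφ : IsSmooth φ) :
    IsSmooth (prolongDeriv θ φ) := by
  refine isSmooth_of_local fun e he ξ hξ => ?_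
  obtain ⟨u, hu⟩ := exists_germ_chart he hξ
  refine ⟨fun a => dirDeriv (inChart e φ) a fun i => inChart e (prolong (θ (u i))) a,
    (hφ.isSmoothAt he hξ).dirDeriv (IsSmoothAt.pi fun i =>
      (isSmooth_prolong (θ (u i))).isSmoothAt he hξ), ?_⟩
  filter_upwards [Filter.eventually_all.mpr fun i => eventually_eventually_nhds.mpr (hu i),
    e.open_source.mem_nhds hξ] with y hy hye ζ hζ
  subst hζ
  rw [prolongDeriv_eq θ he hye hφ]
  congr 1
  funext i
  rw [velocity_eq θ hy, inChart_coord he _ hye]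
  rfl

theorem prolongDeriv_add {φ ψ : NearPoint n M A → W} (hφ : IsSmooth φ) (hψ : IsSmooth ψ) :
    prolongDeriv θ (φ + ψ) = prolongDeriv θ φ + prolongDeriv θ ψ := by
  funext ξ
  have he := IsManifold.chart_mem_maximalAtlas (I := 𝓡 n) (n := ∞) ξ.base
  have hξ := mem_chart_source (EuclideanSpace ℝ (Fin n)) ξ.base
  rw [prolongDeriv, inChart_add, dirDeriv_add (hφ.isSmoothAt he hξ) (hψ.isSmoothAt he hξ)]
  rfl

theorem prolongDeriv_mul {φ ψ : NearPoint n M A → A} (hφ : IsSmooth φ) (hψ : IsSmooth ψ) :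
    prolongDeriv θ (φ * ψ) = φ * prolongDeriv θ ψ + ψ * prolongDeriv θ φ := by
  funext ξ
  have he := IsManifold.chart_mem_maximalAtlas (I := 𝓡 n) (n := ∞) ξ.base
  have hξ := mem_chart_source (EuclideanSpace ℝ (Fin n)) ξ.base
  rw [prolongDeriv, inChart_mul, dirDeriv_mul (hφ.isSmoothAt he hξ) (hψ.isSmoothAt he hξ),
    inChart_coord he _ hξ, inChart_coord he _ hξ]
  rfl

theorem prolongDeriv_linearMap_comp (L : W →ₗ[ℝ] W') {φ : NearPoint n M A → W}
    (hφ : IsSmooth φ) :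
    prolongDeriv θ (fun ξ => L (φ ξ)) = fun ξ => L (prolongDeriv θ φ ξ) := by
  funext ξ
  have he := IsManifold.chart_mem_maximalAtlas (I := 𝓡 n) (n := ∞) ξ.base
  have hξ := mem_chart_source (EuclideanSpace ℝ (Fin n)) ξ.base
  exact dirDeriv_inChart_linearMap_comp he hξ L hφ _

theorem prolongDeriv_prolong (g : C^∞⟮𝓡 n, M; ℝ⟯) :
    prolongDeriv θ (prolong (A := A) g) = prolong (θ g) := by
  funext ξ
  exact dirDeriv_inChart_prolong θ (IsManifold.chart_mem_maximalAtlas _) (mem_chart_source _ _) g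

variable (A) in
/-- The prolongation of a vector field on `M` to a derivation of `C^∞(M^A, A)`. -/
noncomputable def prolongDerivation :
    Derivation A (smoothFunctions n M A) (smoothFunctions n M A) :=
  Derivation.mk'
    { toFun := fun φ => ⟨prolongDeriv θ φ.1, isSmooth_prolongDeriv θ φ.2⟩
      map_add' := fun φ ψ => Subtype.ext (prolongDeriv_add θ φ.2 ψ.2)
      map_smul' := fun a φ => Subtype.ext
        (prolongDeriv_linearMap_comp θ (LinearMap.mulLeft ℝ a) φ.2) }
    fun φ ψ => Subtype.ext (prolongDeriv_mul θ φ.2 ψ.2)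

theorem isExtension_prolongDerivation : IsExtension θ (prolongDerivation A θ) := by
  refine ⟨fun φ ⟨ψ, hψ, hφψ⟩ => ?_, fun g φ hφ => ?_⟩
  · refine ⟨prolongDeriv θ ψ, isSmooth_prolongDeriv θ hψ, fun ξ => ?_⟩
    have h1 : φ.1 = fun ξ => Algebra.linearMap ℝ A (ψ ξ) := funext hφψ
    change prolongDeriv θ φ.1 ξ = _
    rw [h1, prolongDeriv_linearMap_comp θ _ hψ]
    rfl
  · change prolongDeriv θ φ.1 = _
    rw [hφ, prolongDeriv_prolong]

end Prolongation

/-! ### Uniqueness of extensions -/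

section Uniqueness

variable {n : ℕ} {M : Type*} [TopologicalSpace M] [ChartedSpace (EuclideanSpace ℝ (Fin n)) M]
variable {A : Type*} [CommRing A] [Algebra ℝ A] [IsWeilAlgebra A]

/-- Bump functions on a finite-dimensional space without a norm. -/
theorem exists_bump {V : Type*} [AddCommGroup V] [Module ℝ V] [Module.Finite ℝ V] {a : V}
    {p : V → Prop} (hp : ∀ᶠ b in linNhds a, p b) :
    ∃ β : V → ℝ, (∀ b, IsSmoothAt β b) ∧ β a = 1 ∧ ∀ b, β b ≠ 0 → p b := by
  obtain ⟨ε, hε, hball⟩ := Metric.eventually_nhds_iff_ball.mp (eventually_linNhds.mp hp)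
  let χ : ContDiffBump (linCoord V a) := ⟨ε / 2, ε, by positivity, by linarith⟩
  refine ⟨fun b => χ (linCoord V b), fun b => ?_, ?_, fun b hb => ?_⟩
  · exact IsSmoothAt.comp (H := χ) (IsSmoothAt.of_contDiff χ.contDiff _)
      (IsSmoothAt.linearMap (linCoord V).toLinearMap b)
  · exact χ.one_of_mem_closedBall (Metric.mem_closedBall_self χ.rIn_pos.le)
  · have h1 : linCoord V b ∈ Function.support χ := hb
    rw [χ.support_eq] at h1
    simpa using hball _ h1

variable [IsManifold (𝓡 n) ∞ M] [T2Space M]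

/-- The function `H(u₁^A, …, uₙ^A)` for a smooth map `H : A^n → A`, as an element of
`C^∞(M^A, A)`. -/
noncomputable def compProlong (u : Fin n → C^∞⟮𝓡 n, M; ℝ⟯) (H : (Fin n → A) → A)
    (hH : ∀ b, IsSmoothAt H b) : smoothFunctions n M A :=
  ⟨fun ζ => H fun i => prolong (u i) ζ, (IsSmooth.pi fun i => isSmooth_prolong (u i)).comp hH⟩

/-- The real function `μ(g^A)` for a linear functional `μ` on `A`. -/
noncomputable def functionalProlong (μ : A →ₗ[ℝ] ℝ) (g : C^∞⟮𝓡 n, M; ℝ⟯) :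
    smoothFunctions n M A :=
  ⟨fun ζ => algebraMap ℝ A (μ (prolong g ζ)), (isSmooth_prolong g).comp
    fun w => IsSmoothAt.linearMap (Algebra.linearMap ℝ A ∘ₗ μ) w⟩

theorem functionalProlong_mem (μ : A →ₗ[ℝ] ℝ) (g : C^∞⟮𝓡 n, M; ℝ⟯) :
    functionalProlong μ g ∈ realFunctions n M A :=
  ⟨fun ζ => μ (prolong g ζ), (isSmooth_prolong g).comp fun w => IsSmoothAt.linearMap μ w,
    fun _ => rfl⟩

variable {Δ : Derivation A (smoothFunctions n M A) (smoothFunctions n M A)}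

/-- If `Δ` kills `g^A = ∑ b_k g_k`, with `g_k` the real components of `g^A` in a basis `b` of `A`,
and if the `Δ g_k` are real, then they all vanish. -/
theorem derivation_functionalProlong_eq_zero
    (hreal : ∀ φ ∈ realFunctions n M A, ∀ ξ, ∃ r : ℝ, (Δ φ).1 ξ = algebraMap ℝ A r)
    (hzero : ∀ (g : C^∞⟮𝓡 n, M; ℝ⟯) (φ : smoothFunctions n M A), φ.1 = prolong g → Δ φ = 0)
    (μ : A →ₗ[ℝ] ℝ) (g : C^∞⟮𝓡 n, M; ℝ⟯) : Δ (functionalProlong μ g) = 0 := by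
  let b := Module.finBasis ℝ A
  have h1 : ∀ k, Δ (functionalProlong (b.coord k) g) = 0 := fun k => by
    have h2 : Δ (∑ j, b j • functionalProlong (b.coord j) g) = 0 := by
      refine hzero g _ (funext fun ζ => ?_)
      have h3 := b.sum_repr (prolong g ζ)
      refine Eq.trans ?_ h3
      simp only [AddSubmonoidClass.coe_finsetSum, Finset.sum_apply]
      refine Finset.sum_congr rfl fun j _ => ?_
      change b j * algebraMap ℝ A (b.coord j (prolong g ζ)) = _
      rw [mul_comm, ← Algebra.smul_def]
      rfl
    rw [map_sum] at h2
    apply Subtype.ext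
    funext ξ
    choose r hr using fun j => hreal _ (functionalProlong_mem (b.coord j) g) ξ
    have h4 : ∑ j, r j • b j = 0 := by
      have h5 := congrArg (fun s : smoothFunctions n M A => s.1 ξ) h2
      simp only [AddSubmonoidClass.coe_finsetSum, Finset.sum_apply] at h5
      rw [← (show (0 : smoothFunctions n M A).1 ξ = 0 from rfl), ← h5]
      refine Finset.sum_congr rfl fun j _ => ?_
      rw [Δ.map_smul]
      change _ = b j * (Δ (functionalProlong (b.coord j) g)).1 ξ
      rw [hr, mul_comm, ← Algebra.smul_def]
    have h6 := Fintype.linearIndependent_iff.mp b.linearIndependent r h4 k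
    rw [hr, h6, map_zero]
    rfl
  have h7 : functionalProlong μ g =
      ∑ k, algebraMap ℝ A (μ (b k)) • functionalProlong (b.coord k) g := by
    apply Subtype.ext
    funext ζ
    simp only [AddSubmonoidClass.coe_finsetSum, Finset.sum_apply]
    change algebraMap ℝ A (μ (prolong g ζ)) =
      ∑ k, algebraMap ℝ A (μ (b k)) * algebraMap ℝ A (b.coord k (prolong g ζ))
    conv_lhs => rw [← b.sum_repr (prolong g ζ)]
    simp only [map_sum, map_smul, smul_eq_mul, map_mul]
    exact Finset.sum_congr rfl fun k _ => mul_comm _ _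
  rw [h7, map_sum]
  exact Finset.sum_eq_zero fun k _ => by rw [Δ.map_smul, h1, smul_zero]

/-- A derivation of `C^∞(M^A, A)` that sends real functions to real functions is determined by its
values on the functions `g^A`. -/
theorem derivation_eq_zero
    (hreal : ∀ φ ∈ realFunctions n M A, ∀ ξ, ∃ r : ℝ, (Δ φ).1 ξ = algebraMap ℝ A r)
    (hzero : ∀ (g : C^∞⟮𝓡 n, M; ℝ⟯) (φ : smoothFunctions n M A), φ.1 = prolong g → Δ φ = 0) :
    Δ = 0 := by
  ext1 φ
  apply Subtype.ext
  funext ξ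
  obtain ⟨e, he, hξ⟩ : ∃ e ∈ IsManifold.maximalAtlas (𝓡 n) ∞ M, ξ.base ∈ e.source :=
    ⟨_, IsManifold.chart_mem_maximalAtlas ξ.base, mem_chart_source _ _⟩
  obtain ⟨u, hu⟩ := exists_germ_chart he hξ
  have hcoord : (fun i => prolong (u i) ξ) = ξ.coord e := funext fun i => (ξ.coord_eq hu i).symm
  obtain ⟨G, hG, hGφ⟩ :=
    IsSmoothAt.exists_eventuallyEq (IsSmooth.eventually_isSmoothAt φ.2 he hξ)
  let Φ : smoothFunctions n M A := compProlong u G hG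
  -- `Φ` is built from the coordinates by Hadamard's lemma, so that `Δ Φ` vanishes at `ξ`
  have hΦ : (Δ Φ).1 ξ = 0 := by
    obtain ⟨h, hh, hsub⟩ := exists_hadamard hG (ξ.coord e)
    let μ : Fin (Module.finrank ℝ (Fin n → A)) → Fin n → A →ₗ[ℝ] ℝ := fun k i =>
      LinearMap.proj k ∘ₗ (linCoord (Fin n → A)).toLinearMap ∘ₗ LinearMap.single ℝ (fun _ => A) i
    let Λ : Fin (Module.finrank ℝ (Fin n → A)) → smoothFunctions n M A := fun k =>
      ∑ i, functionalProlong (μ k i) (u i) -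
        algebraMap A _ (algebraMap ℝ A (linCoord (Fin n → A) (ξ.coord e) k))
    have hΛ : ∀ k ζ, (Λ k).1 ζ =
        algebraMap ℝ A (linCoord (Fin n → A) ((fun i => prolong (u i) ζ) - ξ.coord e) k) := by
      intro k ζ
      have h1 : (fun i => prolong (A := A) (u i) ζ) =
          ∑ i, LinearMap.single ℝ (fun _ : Fin n => A) i (prolong (u i) ζ) := by
        funext i
        simp [Finset.sum_apply, Pi.single_apply]
      have h2 : (Λ k).1 ζ = (∑ i, algebraMap ℝ A (μ k i (prolong (u i) ζ))) -
          algebraMap ℝ A (linCoord (Fin n → A) (ξ.coord e) k) := by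
        simp only [Λ, AddSubgroupClass.coe_sub, AddSubmonoidClass.coe_finsetSum, Pi.sub_apply,
          Finset.sum_apply]
        rfl
      rw [h2, map_sub, h1, map_sum, Pi.sub_apply, Finset.sum_apply, map_sub, map_sum]
      rfl
    have hΔΛ : ∀ k, Δ (Λ k) = 0 := fun k => by
      rw [map_sub, Derivation.map_algebraMap, map_sum, sub_zero]
      exact Finset.sum_eq_zero fun i _ =>
        derivation_functionalProlong_eq_zero hreal hzero _ _
    have hΛξ : ∀ k, (Λ k).1 ξ = 0 := fun k => by
      rw [hΛ, hcoord, sub_self, map_zero, Pi.zero_apply, map_zero]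
    have hsum : Φ = algebraMap A _ (G (ξ.coord e)) +
        ∑ k, Λ k * compProlong u (h k) (hh k) := by
      apply Subtype.ext
      funext ζ
      simp only [AddMemClass.coe_add, AddSubmonoidClass.coe_finsetSum, Pi.add_apply,
        Finset.sum_apply]
      have h3 := hsub fun i => prolong (u i) ζ
      rw [sub_eq_iff_eq_add'] at h3
      refine h3.trans ?_
      congr 1
      refine Finset.sum_congr rfl fun k _ => ?_
      change _ = (Λ k).1 ζ * h k _
      rw [hΛ, Algebra.smul_def]
    rw [hsum, map_add, Derivation.map_algebraMap, zero_add, map_sum]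
    simp only [AddSubmonoidClass.coe_finsetSum, Finset.sum_apply]
    refine Finset.sum_eq_zero fun k _ => ?_
    rw [Δ.leibniz, hΔΛ, smul_zero, add_zero, smul_eq_mul]
    change (Λ k).1 ξ * _ = 0
    rw [hΛξ, zero_mul]
  -- `κ` is `1` at `ξ` and vanishes wherever `φ` and `Φ` differ
  obtain ⟨χ, -, hχ⟩ := (SmoothBumpFunction.nhds_basis_tsupport (I := 𝓡 n) ξ.base).mem_iff.mp
    ((Filter.eventually_all.mpr fun i => eventually_eventually_nhds.mpr (hu i)).and
      (e.open_source.mem_nhds hξ))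
  obtain ⟨β, hβ, hβ1, hβG⟩ := exists_bump hGφ
  let c : C^∞⟮𝓡 n, M; ℝ⟯ := ⟨χ, χ.contMDiff⟩
  let κ : smoothFunctions n M A :=
    functionalProlong (augmentation A).toLinearMap c *
      compProlong u (fun b => algebraMap ℝ A (β b)) fun b =>
        (IsSmoothAt.linearMap (Algebra.linearMap ℝ A) _).comp (hβ b)
  have hκ : ∀ ζ, κ.1 ζ = algebraMap ℝ A (χ ζ.base) *
      algebraMap ℝ A (β fun i => prolong (u i) ζ) := fun ζ => by
    change algebraMap ℝ A (augmentation A (ζ.toAlgHom c)) * _ = _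
    rw [ζ.augmentation_toAlgHom]
    rfl
  have hvanish : κ * (φ - Φ) = 0 := by
    apply Subtype.ext
    funext ζ
    change κ.1 ζ * (φ.1 ζ - G fun i => prolong (u i) ζ) = 0
    rw [hκ]
    by_cases h1 : χ ζ.base = 0
    · rw [h1, map_zero, zero_mul, zero_mul]
    by_cases h2 : (β fun i => prolong (u i) ζ) = 0
    · rw [h2, map_zero, mul_zero, zero_mul]
    obtain ⟨h3, h4⟩ := hχ (subset_tsupport _ h1)
    have h5 : (fun i => prolong (u i) ζ) = ζ.coord e := funext fun i => (ζ.coord_eq h3 i).symm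
    have h6 := hβG _ h2
    rw [h6, h5, inChart_coord he _ h4, sub_self, mul_zero]
  have h1 := congrArg (fun s : smoothFunctions n M A => s.1 ξ) (congrArg Δ hvanish)
  rw [Δ.leibniz, map_zero, map_sub] at h1
  change κ.1 ξ * ((Δ φ).1 ξ - (Δ Φ).1 ξ) + (φ.1 ξ - G fun i => prolong (u i) ξ) * (Δ κ).1 ξ = 0
    at h1
  have h2 : χ ξ.base = 1 := χ.eq_one
  rw [hκ, hΦ, hcoord, hβ1, h2, self_of_eventually_linNhds hGφ, inChart_coord he _ hξ,
    sub_self, zero_mul, map_one, add_zero, one_mul, one_mul, sub_zero] at h1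
  exact h1

theorem IsExtension.eq {θ : C^∞⟮𝓡 n, M; ℝ⟯ → C^∞⟮𝓡 n, M; ℝ⟯}
    {D D' : Derivation A (smoothFunctions n M A) (smoothFunctions n M A)}
    (hD : IsExtension θ D) (hD' : IsExtension θ D') : D = D' := by
  rw [← sub_eq_zero]
  refine derivation_eq_zero (fun φ hφ ξ => ?_) fun g φ hφ => ?_
  · obtain ⟨ψ, -, hψ⟩ := hD.1 φ hφ
    obtain ⟨ψ', -, hψ'⟩ := hD'.1 φ hφ
    refine ⟨ψ ξ - ψ' ξ, ?_⟩
    change (D φ).1 ξ - (D' φ).1 ξ = _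
    rw [hψ, hψ', map_sub]
  · rw [Derivation.sub_apply, sub_eq_zero]
    exact Subtype.ext ((hD.2 g φ hφ).trans (hD'.2 g φ hφ).symm)

end Uniqueness

/-! ### The representation and its cohomology operator -/

section Representation

variable {n : ℕ} {M : Type*} [TopologicalSpace M] [ChartedSpace (EuclideanSpace ℝ (Fin n)) M]
variable {A : Type*} [CommRing A] [Algebra ℝ A] [IsWeilAlgebra A]
variable [IsManifold (𝓡 n) ∞ M] [T2Space M]

theorem add_mem_realFunctions {φ ψ : smoothFunctions n M A} (hφ : φ ∈ realFunctions n M A)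
    (hψ : ψ ∈ realFunctions n M A) : φ + ψ ∈ realFunctions n M A := by
  obtain ⟨f, hf, hφf⟩ := hφ
  obtain ⟨g, hg, hψg⟩ := hψ
  refine ⟨f + g, isSmooth_of_local fun e he ξ hξ => ⟨fun a => inChart e f a + inChart e g a,
    (hf.isSmoothAt he hξ).add (hg.isSmoothAt he hξ), ?_⟩, fun ξ => ?_⟩
  · rw [← inChart_add]
    exact eventually_eq_inChart he (f + g) hξ
  · change φ.1 ξ + ψ.1 ξ = algebraMap ℝ A (f ξ + g ξ)
    rw [hφf, hψg, map_add]

theorem smul_mem_realFunctions (r : ℝ) {φ : smoothFunctions n M A}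
    (hφ : φ ∈ realFunctions n M A) : r • φ ∈ realFunctions n M A := by
  obtain ⟨f, hf, hφf⟩ := hφ
  refine ⟨fun ξ => LinearMap.lsmul ℝ ℝ r (f ξ), hf.comp fun w => IsSmoothAt.linearMap _ w,
    fun ξ => ?_⟩
  change r • φ.1 ξ = algebraMap ℝ A (r * f ξ)
  rw [hφf, map_mul, Algebra.smul_def]

theorem prolong_mem_smoothFunctions (g : C^∞⟮𝓡 n, M; ℝ⟯) :
    prolong g ∈ smoothFunctions n M A := isSmooth_prolong g

namespace PoissonBracket

variable (P : PoissonBracket n M)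

/-- The Hamiltonian vector field `ad(f) = {f, ·}`. -/
noncomputable def hamiltonian (f : C^∞⟮𝓡 n, M; ℝ⟯) :
    Derivation ℝ C^∞⟮𝓡 n, M; ℝ⟯ C^∞⟮𝓡 n, M; ℝ⟯ :=
  Derivation.mk' (P.bracket f) fun g h => by
    rw [P.leibniz, smul_eq_mul, smul_eq_mul]
    ring

theorem isExtension_hamiltonian (f : C^∞⟮𝓡 n, M; ℝ⟯) :
    IsExtension (P.bracket f) (prolongDerivation A (P.hamiltonian f)) :=
  isExtension_prolongDerivation (P.hamiltonian f)

theorem bracket_bracket (f g h : C^∞⟮𝓡 n, M; ℝ⟯) : P.bracket (P.bracket f g) h =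
    P.bracket f (P.bracket g h) - P.bracket g (P.bracket f h) := by
  have h1 := P.jacobi f g h
  have hskew := ChevalleyEilenberg.bracket_skew P.bracket_self
  rw [hskew (P.bracket f g) h, hskew f h, map_neg, ← sub_eq_add_neg,
    ← sub_eq_add_neg, sub_eq_zero] at h1
  exact h1.symm

variable (A) in
/-- The representation `f ↦ [ad(f)]^A` of the Lie algebra `C^∞(M)` on `C^∞(M^A, A)`. -/
noncomputable def representation : C^∞⟮𝓡 n, M; ℝ⟯ →ₗ[ℝ]
    Derivation A (smoothFunctions n M A) (smoothFunctions n M A) where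
  toFun f := prolongDerivation A (P.hamiltonian f)
  map_add' f g := by
    have hf := P.isExtension_hamiltonian (A := A) f
    have hg := P.isExtension_hamiltonian (A := A) g
    refine (P.isExtension_hamiltonian (f + g)).eq ⟨fun φ hφ =>
      add_mem_realFunctions (hf.1 φ hφ) (hg.1 φ hφ), fun h φ hφ => ?_⟩
    change (prolongDerivation A (P.hamiltonian f) φ).1 +
      (prolongDerivation A (P.hamiltonian g) φ).1 = _
    rw [hf.2 h φ hφ, hg.2 h φ hφ, map_add]
    funext ξ
    exact (map_add ξ.toAlgHom _ _).symm
  map_smul' r f := by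
    have hf := P.isExtension_hamiltonian (A := A) f
    refine (P.isExtension_hamiltonian (r • f)).eq ⟨fun φ hφ =>
      smul_mem_realFunctions r (hf.1 φ hφ), fun h φ hφ => ?_⟩
    change r • (prolongDerivation A (P.hamiltonian f) φ).1 = _
    rw [hf.2 h φ hφ, map_smul]
    funext ξ
    exact (map_smul ξ.toAlgHom _ _).symm

theorem isExtension_representation (f : C^∞⟮𝓡 n, M; ℝ⟯) :
    IsExtension (P.bracket f) (P.representation A f) := P.isExtension_hamiltonian f

theorem representation_bracket (f g : C^∞⟮𝓡 n, M; ℝ⟯) :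
    P.representation A (P.bracket f g) = ⁅P.representation A f, P.representation A g⁆ := by
  have hf := P.isExtension_representation (A := A) f
  have hg := P.isExtension_representation (A := A) g
  refine (P.isExtension_representation (P.bracket f g)).eq ⟨fun φ hφ => ?_, fun h φ hφ => ?_⟩
  · rw [Derivation.commutator_apply, sub_eq_add_neg, ← neg_one_smul ℝ]
    exact add_mem_realFunctions (hf.1 _ (hg.1 φ hφ))
      (smul_mem_realFunctions _ (hg.1 _ (hf.1 φ hφ)))
  · rw [Derivation.commutator_apply, P.bracket_bracket]
    change (P.representation A f (P.representation A g φ)).1 -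
      (P.representation A g (P.representation A f φ)).1 = _
    rw [hf.2 _ _ (hg.2 h φ hφ), hg.2 _ _ (hf.2 h φ hφ)]
    funext ξ
    exact (map_sub ξ.toAlgHom _ _).symm

variable (A) in
/-- The representation with values in real linear endomorphisms. -/
noncomputable def representationEnd : C^∞⟮𝓡 n, M; ℝ⟯ →ₗ[ℝ]
    smoothFunctions n M A →ₗ[ℝ] smoothFunctions n M A where
  toFun f := (P.representation A f).toLinearMap.restrictScalars ℝ
  map_add' f g := by
    rw [map_add]
    rfl
  map_smul' r f := by
    rw [map_smul]
    rfl

theorem differential_apply {p : ℕ} (Ω : Cochain n M A p) (f : Fin (p + 1) → C^∞⟮𝓡 n, M; ℝ⟯) :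
    ChevalleyEilenberg.differential P.bracket (P.representationEnd A) p Ω f =
      coboundary P (P.representation A) Ω f := by
  cases p with
  | zero =>
    rw [ChevalleyEilenberg.differential_zero_apply, coboundary, bracketTerms, add_zero]
    rfl
  | succ p =>
    rw [ChevalleyEilenberg.differential_succ_apply P.bracket_self]
    rfl

variable (A) in
/-- The cohomology operator `d̃` of the representation `f ↦ [ad(f)]^A`, an `A`-linear map. -/
noncomputable def cohomologyOperator (p : ℕ) : Cochain n M A p →ₗ[A] Cochain n M A (p + 1) where
  toFun := ChevalleyEilenberg.differential P.bracket (P.representationEnd A) p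
  map_add' := map_add _
  map_smul' a Ω := by
    ext1 f
    rw [AlternatingMap.smul_apply, differential_apply, differential_apply]
    cases p with
    | zero =>
      simp only [coboundary, bracketTerms, add_zero, AlternatingMap.smul_apply, Derivation.map_smul,
        Finset.smul_sum, RingHom.id_apply]
      exact Finset.sum_congr rfl fun i _ => smul_comm _ _ _
    | succ p =>
      simp only [coboundary, bracketTerms, AlternatingMap.smul_apply, Derivation.map_smul, smul_add,
        Finset.smul_sum, smul_ite, smul_zero, RingHom.id_apply]
      congr 1
      · exact Finset.sum_congr rfl fun i _ => smul_comm _ _ _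
      · refine Finset.sum_congr rfl fun j _ => Finset.sum_congr rfl fun i _ => ?_
        rw [smul_comm a]

end PoissonBracket

end Representation

end WeilBundle

theorem mainTheorem1 {n : ℕ} {M : Type*} [TopologicalSpace M]
    [ChartedSpace (EuclideanSpace ℝ (Fin n)) M] [IsManifold (𝓡 n) ∞ M] [T2Space M]
    [ParacompactSpace M] {A : Type*} [CommRing A] [Algebra ℝ A] [IsWeilAlgebra A]
    (P : WeilBundle.PoissonBracket n M) :
    -- the functions `g^A` belong to `C^∞(M^A, A)`
    (∀ g : C^∞⟮𝓡 n, M; ℝ⟯, WeilBundle.prolong g ∈ WeilBundle.smoothFunctions n M A) ∧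
    -- each prolonged Hamiltonian vector field has a unique extension
    (∀ f : C^∞⟮𝓡 n, M; ℝ⟯,
      ∃! D : Derivation A (WeilBundle.smoothFunctions n M A) (WeilBundle.smoothFunctions n M A),
        WeilBundle.IsExtension (P.bracket f) D) ∧
    -- these extensions form a representation of the Lie algebra `C^∞(M)`
    ∃ ρ : C^∞⟮𝓡 n, M; ℝ⟯ →ₗ[ℝ]
        Derivation A (WeilBundle.smoothFunctions n M A) (WeilBundle.smoothFunctions n M A),
      (∀ f, WeilBundle.IsExtension (P.bracket f) (ρ f)) ∧
      (∀ f g, ρ (P.bracket f g) = ⁅ρ f, ρ g⁆) ∧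
      -- and the representation has a cohomology operator
      ∃ d : ∀ p : ℕ, WeilBundle.Cochain n M A p →ₗ[A] WeilBundle.Cochain n M A (p + 1),
        (∀ (p : ℕ) (Ω : WeilBundle.Cochain n M A p) (f : Fin (p + 1) → C^∞⟮𝓡 n, M; ℝ⟯),
          d p Ω f = WeilBundle.coboundary P ρ Ω f) ∧
        ∀ (p : ℕ) (Ω : WeilBundle.Cochain n M A p), d (p + 1) (d p Ω) = 0 := by
  refine ⟨WeilBundle.prolong_mem_smoothFunctions,
    fun f => ⟨_, P.isExtension_representation f, fun D hD =>
      hD.eq (P.isExtension_representation f)⟩,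
    P.representation A, P.isExtension_representation, P.representation_bracket,
    P.cohomologyOperator A, fun p Ω f => P.differential_apply Ω f, fun p Ω => ?_⟩
  refine ChevalleyEilenberg.differential_differential P.bracket_self P.bracket_bracket
    (fun f g φ => ?_) p Ω
  change P.representation A (P.bracket f g) φ = _
  rw [P.representation_bracket, Derivation.commutator_apply]
  rfl
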